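/- Consider the structural causal model $Y=f(X,E)$, $X\perp E$, with $X,Y\in[n]$ and $E\in[m]$. Let the distribution $p(X)$ be drawn uniformly at random from the probability simplex $\Delta_n$, let $f$ be drawn, independently of $p(X)$, uniformly at random from all maps $[n]\times[m]\to[n]$, and, given $p(X)$ and $f$, let $(X_1,Y_1),\dots,(X_N,Y_N)$ be i.i.d. samples from the joint distribution of $(X,Y)$. Let $\hat p(Y|X=x)$, for each $x$ occurring in the sample, and $\hat p(X|Y=y)$, for each $y$ occurring in the sample, be the plug-in (empirical) conditional distributions. For a finite family of distributions let $\mathcal A(\cdot)$ denote the entropy (in bits) of its minimum entropy coupling, i.e. the smallest Shannon entropy of a joint distribution having the members of the family as its marginals. Then, for every $c$, every $C>0$ and every $\varepsilon>0$, there is an $n_0=n_0(c,C,\varepsilon)$ such that for all $n\ge n_0$, all $m$, all distributions $p(E)$ on $[m]$ with $H(E)\le c$, and all $N\ge C\,n^8\log_2^5 n$, $$\Pr\bigl[\mathcal A(\{\hat p(X|Y=y)\}_y)>\mathcal A(\{\hat p(Y|X=x)\}_x)\bigr]\ge 1-\varepsilon ,$$ where the probability is over $p(X)$, $f$ and the samples.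 That is, if $H(E)=\mathcal O(1)$ and $N=\Omega(n^8\log^5 n)$, the comparison identifies the causal direction $X\to Y$ with probability tending to $1$ as $n\to\infty$. -/

import Mathlib

open MeasureTheory ProbabilityTheory
open scoped ENNReal

noncomputable section

namespace EntropicCausality

/-- Shannon entropy, in bits, of a probability vector (with `0 log 0 = 0`). -/
def entropy {α : Type*} [Fintype α] (p : α → ℝ) : ℝ :=
  (∑ a, Real.negMulLog (p a)) / Real.log 2

/-- `r` is a joint distribution of a tuple of `α`-valued variables indexed by `ι`
whose `k`-th marginal is `q k`, for every `k`. -/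
def IsCoupling {ι α : Type*} [Fintype ι] [DecidableEq ι] [Fintype α] [DecidableEq α]
    (q : ι → α → ℝ) (r : (ι → α) → ℝ) : Prop :=
  r ∈ stdSimplex ℝ (ι → α) ∧ ∀ k a, ∑ u with u k = a, r u = q k a

/-- The entropy of the minimum entropy coupling of the distributions `q k`, `k : ι`.
By `isLeast_minCouplingEntropy` the infimum is a minimum. -/
def minCouplingEntropy {ι α : Type*} [Fintype ι] [DecidableEq ι] [Fintype α] [DecidableEq α]
    (q : ι → α → ℝ) : ℝ :=
  sInf (entropy '' {r : (ι → α) → ℝ | IsCoupling q r})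

theorem isLeast_minCouplingEntropy {ι α : Type*} [Fintype ι] [DecidableEq ι] [Fintype α]
    [DecidableEq α] (q : ι → α → ℝ) (hq : ∀ k, q k ∈ stdSimplex ℝ α) :
    IsLeast (entropy '' {r : (ι → α) → ℝ | IsCoupling q r}) (minCouplingEntropy q) := by
  have hne : {r : (ι → α) → ℝ | IsCoupling q r}.Nonempty := by
    refine ⟨fun u => ∏ k, q k (u k), ⟨fun u => Finset.prod_nonneg fun k _ => (hq k).1 _, ?_⟩, ?_⟩
    · rw [← Fintype.prod_sum]
      exact Finset.prod_eq_one fun k _ => (hq k).2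
    · intro k a
      have h : ∀ u : ι → α, (if u k = a then ∏ j, q j (u j) else 0)
          = ∏ j, (if j = k then (if u j = a then q j (u j) else 0) else q j (u j)) := by
        intro u
        by_cases hu : u k = a
        · rw [if_pos hu]
          refine Finset.prod_congr rfl fun j _ => ?_
          by_cases hj : j = k
          · subst hj; simp [hu]
          · simp [hj]
        · rw [if_neg hu]
          exact (Finset.prod_eq_zero (Finset.mem_univ k) (by simp [hu])).symm
      rw [Finset.sum_filter, Finset.sum_congr rfl fun u _ => h u,
        ← Fintype.prod_sum (fun j b => if j = k then (if b = a then q j b else 0) else q j b),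
        Finset.prod_eq_single k]
      · simp
      · intro j _ hj
        simpa [hj] using (hq j).2
      · simp
  have hcomp : IsCompact {r : (ι → α) → ℝ | IsCoupling q r} := by
    refine (isCompact_stdSimplex ℝ (ι → α)).of_isClosed_subset ?_ fun r hr => hr.1
    have h : IsClosed {r : (ι → α) → ℝ | ∀ k a, ∑ u with u k = a, r u = q k a} := by
      have h' : {r : (ι → α) → ℝ | ∀ k a, ∑ u with u k = a, r u = q k a}
          = ⋂ k, ⋂ a, {r : (ι → α) → ℝ | ∑ u with u k = a, r u = q k a} := by
        ext r
        simp
      rw [h']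
      refine isClosed_iInter fun k => isClosed_iInter fun a => isClosed_eq ?_ continuous_const
      fun_prop
    exact (isClosed_stdSimplex ℝ (ι → α)).inter h
  have hcont : Continuous (entropy : ((ι → α) → ℝ) → ℝ) := by
    unfold entropy
    exact (continuous_finsetSum _ fun u _ =>
      Real.continuous_negMulLog.comp (continuous_apply u)).div_const _
  exact (hcomp.image hcont).isLeast_sInf (hne.image _)

/-- The uniform distribution on the probability simplex in `n` dimensions: the normalized
`(n - 1)`-dimensional Hausdorff measure on it. (After normalization it does not matter which
norm of `ℝⁿ` the Hausdorff measure comes from.) -/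
def simplexUniform (n : ℕ) : Measure (Fin n → ℝ) :=
  ProbabilityTheory.cond (Measure.hausdorffMeasure ((n : ℝ) - 1)) (stdSimplex ℝ (Fin n))

/-- The law on a finite type with point masses `p`. -/
def finiteLaw {α : Type*} [Fintype α] [MeasurableSpace α] (p : α → ℝ) : Measure α :=
  ∑ a, ENNReal.ofReal (p a) • Measure.dirac a

/-- The law of `(X, Y)` in the structural causal model `Y = f (X, E)`, with `X ∼ pX` and `E ∼ pE`
independent. -/
def scmLaw {n m : ℕ} (pX : Fin n → ℝ) (pE : Fin m → ℝ) (f : Fin n × Fin m → Fin n) :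
    Measure (Fin n × Fin n) :=
  ((finiteLaw pX).prod (finiteLaw pE)).map fun xe => (xe.1, f xe)

/-- The law of the data `(X₁, Y₁), …, (X_N, Y_N)` when `pX` is uniform on the simplex, `f` is
independent of it and uniform among all maps `[n] × [m] → [n]`, and, given `pX` and `f`, the
`(Xᵢ, Yᵢ)` are i.i.d. samples of the structural causal model. -/
def dataLaw (n : ℕ) {m : ℕ} (pE : Fin m → ℝ) (N : ℕ) : Measure (Fin N → Fin n × Fin n) :=
  ((simplexUniform n).prod (uniformOn (Set.univ : Set (Fin n × Fin m → Fin n)))).bind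
    fun θ => Measure.pi fun _ : Fin N => scmLaw θ.1 pE θ.2

section Empirical

variable {n N : ℕ} (s : Fin N → Fin n × Fin n)

/-- The empirical joint probability of `(x, y)`. -/
def empJoint (x y : Fin n) : ℝ := (∑ i, if (s i).1 = x ∧ (s i).2 = y then 1 else 0) / N

/-- The empirical probability of `X = x`. -/
def empX (x : Fin n) : ℝ := (∑ i, if (s i).1 = x then 1 else 0) / N

/-- The empirical probability of `Y = y`. -/
def empY (y : Fin n) : ℝ := (∑ i, if (s i).2 = y then 1 else 0) / N

/-- The values of `X` that occur in the sample. -/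
def observedX : Finset (Fin n) := Finset.univ.image fun i => (s i).1

/-- The values of `Y` that occur in the sample. -/
def observedY : Finset (Fin n) := Finset.univ.image fun i => (s i).2

/-- The plug-in conditional distributions of `Y` given `X = x`, one for each observed `x`
(for the other `x` the quotient is `0 / 0`). -/
def condYgivenX (x : observedX s) (y : Fin n) : ℝ := empJoint s x y / empX s x

/-- The plug-in conditional distributions of `X` given `Y = y`, one for each observed `y`
(for the other `y` the quotient is `0 / 0`). -/
def condXgivenY (y : observedY s) (x : Fin n) : ℝ := empJoint s x y / empY s y

end Empirical

end EntropicCausality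

end

open EntropicCausality

namespace EntropicCausality

/-! Only a constant gap is needed: the causal coupling entropy stays below `c + 2 / log 2 + 1`,
while one well-chosen output `y` pushes the anticausal one above this bound. Causal side: the maps
`e ↦ f (x, e)` couple the true conditionals of `Y` at entropy at most `H(E)`. Passing to the
empirical conditionals moves only a small mass, and the entropy of that mass is at most `n log n`,
so a total error of order `1 / (n log n)` costs `O(1)` bits (`minCouplingEntropy_le_of_close`).
Anticausal side: any coupling has at least the entropy of each of its marginals, so a single `y`
with large `H(X | Y = y)` is enough. Some `e` has probability at least `2 ^ (-c)`, and with high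
probability a constant fraction of the `p x` have order `1 / n`. The map `x ↦ f (x, e)` throws these
`x` like balls into `n` bins. For each fixed `K`, some bin gets at least `K` of them with
probability tending to `1`, even among the bins that receive mass at most `2 / n` from everything
else (`uniformOn_not_hasHeavyOutput_le`). For such a `y`, a fixed share of the conditional mass is
spread nearly evenly over at least `K` points, so the entropy is at least a constant times `log K`;
a large constant `K` beats the causal bound. The two sides are linked by a second-moment bound on
the sampling error weighted by `1 / p x` (`measure_sqError_ge_le`), valid when no `p x` is below
order `1 / n ^ 2`. -/

/-! ### Elementary entropy inequalities -/

lemma negMulLog_add_le {a b : ℝ} (ha : 0 ≤ a) (hb : 0 ≤ b) :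
    Real.negMulLog (a + b) ≤ Real.negMulLog a + Real.negMulLog b := by
  rcases ha.eq_or_lt with rfl | ha
  · simp
  rcases hb.eq_or_lt with rfl | hb
  · simp
  have h1 : Real.log a ≤ Real.log (a + b) := Real.log_le_log ha (by linarith)
  have h2 : Real.log b ≤ Real.log (a + b) := Real.log_le_log hb (by linarith)
  simp only [Real.negMulLog]
  nlinarith

lemma negMulLog_sum_le {ι : Type*} (s : Finset ι) (p : ι → ℝ) (hp : ∀ i, 0 ≤ p i) :
    Real.negMulLog (∑ i ∈ s, p i) ≤ ∑ i ∈ s, Real.negMulLog (p i) := by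
  classical
  induction s using Finset.induction_on with
  | empty => simp
  | insert a s ha ih =>
    rw [Finset.sum_insert ha, Finset.sum_insert ha]
    exact (negMulLog_add_le (hp a) (Finset.sum_nonneg fun i _ => hp i)).trans (by linarith)

/-- Entropy does not increase under push-forward. -/
lemma entropy_map_le {α β : Type*} [Fintype α] [Fintype β] [DecidableEq α]
    (g : β → α) (r : β → ℝ) (hr : ∀ u, 0 ≤ r u) :
    entropy (fun a => ∑ u with g u = a, r u) ≤ entropy r := by
  unfold entropy
  refine div_le_div_of_nonneg_right ?_ (Real.log_nonneg (by norm_num))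
  rw [← Finset.sum_fiberwise Finset.univ g fun u => Real.negMulLog (r u)]
  exact Finset.sum_le_sum fun a _ => negMulLog_sum_le _ r hr

lemma entropy_le_logb_card {α : Type*} [Fintype α] {p : α → ℝ} (hp : p ∈ stdSimplex ℝ α) :
    entropy p ≤ Real.logb 2 (Fintype.card α) := by
  have hne : Nonempty α := by
    by_contra h
    rw [not_nonempty_iff] at h
    simpa using hp.2
  have hC : (0 : ℝ) < Fintype.card α := by exact_mod_cast Fintype.card_pos
  unfold entropy Real.logb
  refine div_le_div_of_nonneg_right ?_ (Real.log_nonneg (by norm_num))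
  have key : ∀ a, Real.negMulLog (p a)
      ≤ ((Fintype.card α : ℝ)⁻¹ - p a) + p a * Real.log (Fintype.card α) := by
    intro a
    rcases (hp.1 a).eq_or_lt with h | h
    · rw [← h]; simp
    have h1 := Real.log_le_sub_one_of_pos (x := (p a * Fintype.card α)⁻¹) (by positivity)
    rw [Real.log_inv, Real.log_mul h.ne' hC.ne'] at h1
    have h2 := mul_le_mul_of_nonneg_left h1 h.le
    have h3 : p a * ((p a * Fintype.card α)⁻¹ - 1) = (Fintype.card α : ℝ)⁻¹ - p a := by
      field_simp
    rw [h3] at h2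
    simp only [Real.negMulLog]
    linarith
  refine (Finset.sum_le_sum fun a _ => key a).trans ?_
  rw [Finset.sum_add_distrib, Finset.sum_sub_distrib, ← Finset.sum_mul, hp.2]
  simp [hC.ne']

lemma one_sub_prod_le {ι : Type*} (s : Finset ι) (w : ι → ℝ) (h0 : ∀ k, 0 ≤ w k) (h1 : ∀ k, w k ≤ 1) :
    1 - ∏ k ∈ s, w k ≤ ∑ k ∈ s, (1 - w k) := by
  classical
  induction s using Finset.induction_on with
  | empty => simp
  | insert a s ha ih =>
    rw [Finset.sum_insert ha, Finset.prod_insert ha]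
    have := Finset.prod_nonneg (s := s) fun k _ => h0 k
    have := Finset.prod_le_one (s := s) (fun k _ => h0 k) fun k _ => h1 k
    nlinarith [h0 a, h1 a]

lemma negMulLog_le_one (x : ℝ) (hx : 0 ≤ x) : Real.negMulLog x ≤ 1 := by
  rcases hx.eq_or_lt with rfl | h
  · simp
  have h1 := Real.log_le_sub_one_of_pos (x := x⁻¹) (by positivity)
  rw [Real.log_inv] at h1
  have h2 := mul_le_mul_of_nonneg_left h1 h.le
  have : x * (x⁻¹ - 1) = 1 - x := by field_simp
  simp only [Real.negMulLog]
  linarith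

/-! ### Minimum entropy couplings and their stability -/

section Coupling

variable {ι α : Type*} [Fintype ι] [DecidableEq ι] [Fintype α] [DecidableEq α]

lemma exists_isCoupling (q : ι → α → ℝ) (hq : ∀ k, q k ∈ stdSimplex ℝ α) :
    ∃ r, IsCoupling q r :=
  let ⟨r, hr, _⟩ := (isLeast_minCouplingEntropy q hq).1
  ⟨r, hr⟩

/-- A marginal is a push-forward of the coupling, so its entropy is no larger. This is the only
lower bound used for the anticausal direction. -/
lemma entropy_le_minCouplingEntropy (q : ι → α → ℝ) (hq : ∀ k, q k ∈ stdSimplex ℝ α) (k : ι) :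
    entropy (q k) ≤ minCouplingEntropy q := by
  obtain ⟨r, hr, h⟩ := (isLeast_minCouplingEntropy q hq).1
  rw [← h]
  have := entropy_map_le (fun u : ι → α => u k) r hr.1.1
  simpa only [hr.2 k] using this

/-- A functional representation `Z k = φ k E` yields a coupling of the laws of the `Z k`. -/
lemma exists_isCoupling_of_map {ε : Type*} [Fintype ε] (pE : ε → ℝ) (hE : pE ∈ stdSimplex ℝ ε)
    (φ : ι → ε → α) :
    ∃ r, IsCoupling (fun k a => ∑ e with φ k e = a, pE e) r ∧ entropy r ≤ entropy pE := by
  refine ⟨fun u => ∑ e with (fun k => φ k e) = u, pE e, ⟨⟨fun u =>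
    Finset.sum_nonneg fun e _ => hE.1 e, ?_⟩, ?_⟩, entropy_map_le _ pE hE.1⟩
  · rw [Finset.sum_fiberwise, hE.2]
  · intro k a
    simp only [Finset.sum_filter]
    rw [← Finset.sum_filter, Finset.sum_comm]
    refine Finset.sum_congr rfl fun e _ => ?_
    rw [Finset.sum_ite_eq]
    simp

/-- A coupling of `q` can be turned into a coupling of a nearby family `q'` at a bounded cost in
entropy. -/
lemma minCouplingEntropy_le_of_close (q q' : ι → α → ℝ)
    (hq' : ∀ k, q' k ∈ stdSimplex ℝ α) (r : (ι → α) → ℝ) (hr : IsCoupling q r) (η : ℝ)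
    (hη : ∑ k, ∑ a, |q k a - q' k a| ≤ η) :
    minCouplingEntropy q' ≤ entropy r + 2 / Real.log 2
      + η * (Fintype.card ι * Real.logb 2 (Fintype.card α)) := by
  have hlog2 : 0 < Real.log 2 := Real.log_pos (by norm_num)
  have hq0 : ∀ k a, 0 ≤ q k a := fun k a => by
    rw [← hr.2 k a]; exact Finset.sum_nonneg fun u _ => hr.1.1 u
  -- Thin the coupling `r`: `v k a` is the fraction of the mass at `a` that `q' k` can accommodate.
  -- Multiplying all the fractions gives a sub-coupling `t` whose marginals lie below `q'`. Where `q
  -- k a = 0` the quotient is `0`, which is harmless as `r` has no mass there.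
  set v : ι → α → ℝ := fun k a => min 1 (q' k a / q k a) with hv
  have hv0 : ∀ k a, 0 ≤ v k a := fun k a => le_min zero_le_one (div_nonneg ((hq' k).1 a) (hq0 k a))
  have hv1 : ∀ k a, v k a ≤ 1 := fun k a => min_le_left _ _
  set w : (ι → α) → ℝ := fun u => ∏ k, v k (u k) with hw
  have hw0 : ∀ u, 0 ≤ w u := fun u => Finset.prod_nonneg fun k _ => hv0 k _
  have hw1 : ∀ u, w u ≤ 1 := fun u => Finset.prod_le_one (fun k _ => hv0 k _) fun k _ => hv1 k _
  have hwv : ∀ u k, w u ≤ v k (u k) := by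
    intro u k
    simp only [hw]
    rw [← Finset.mul_prod_erase _ _ (Finset.mem_univ k)]
    exact mul_le_of_le_one_right (hv0 _ _)
      (Finset.prod_le_one (fun j _ => hv0 j _) fun j _ => hv1 j _)
  set t : (ι → α) → ℝ := fun u => r u * w u with ht
  have ht0 : ∀ u, 0 ≤ t u := fun u => mul_nonneg (hr.1.1 u) (hw0 u)
  set M : ι → α → ℝ := fun k a => ∑ u with u k = a, t u with hM
  have hMq : ∀ k a, M k a ≤ q' k a := by
    intro k a
    have h1 : M k a ≤ ∑ u with u k = a, r u * v k a := by
      refine Finset.sum_le_sum fun u hu => ?_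
      have := hwv u k
      rw [(Finset.mem_filter.1 hu).2] at this
      exact mul_le_mul_of_nonneg_left this (hr.1.1 u)
    rw [← Finset.sum_mul, hr.2] at h1
    refine h1.trans ?_
    rcases (hq0 k a).eq_or_lt with h | h
    · rw [← h]; simpa using (hq' k).1 a
    · calc q k a * v k a ≤ q k a * (q' k a / q k a) :=
          mul_le_mul_of_nonneg_left (min_le_right _ _) h.le
        _ = q' k a := by field_simp
  have hMs : ∀ k, ∑ a, M k a = ∑ u, t u := fun k =>
    Finset.sum_fiberwise Finset.univ (fun u : ι → α => u k) t
  set δ : ℝ := 1 - ∑ u, t u with hδ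
  have hδr : δ = ∑ u, r u * (1 - w u) := by
    simp only [hδ, ht, mul_sub, mul_one, Finset.sum_sub_distrib, hr.1.2]
  have hδ0 : 0 ≤ δ := by
    rw [hδr]
    exact Finset.sum_nonneg fun u _ => mul_nonneg (hr.1.1 u) (sub_nonneg.2 (hw1 u))
  have hδη : δ ≤ η := by
    refine le_trans ?_ hη
    calc δ = ∑ u, r u * (1 - w u) := hδr
      _ ≤ ∑ u, r u * ∑ k, (1 - v k (u k)) := Finset.sum_le_sum fun u _ =>
          mul_le_mul_of_nonneg_left
            (one_sub_prod_le _ _ (fun k => hv0 k _) fun k => hv1 k _) (hr.1.1 u)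
      _ = ∑ k, ∑ a, q k a * (1 - v k a) := by
          simp only [Finset.mul_sum]
          rw [Finset.sum_comm]
          refine Finset.sum_congr rfl fun k _ => ?_
          rw [← Finset.sum_fiberwise Finset.univ (fun u : ι → α => u k)]
          refine Finset.sum_congr rfl fun a _ => ?_
          rw [← hr.2 k a, Finset.sum_mul]
          refine Finset.sum_congr rfl fun u hu => ?_
          rw [(Finset.mem_filter.1 hu).2]
      _ ≤ ∑ k, ∑ a, |q k a - q' k a| := by
          refine Finset.sum_le_sum fun k _ => Finset.sum_le_sum fun a _ => ?_
          rcases (hq0 k a).eq_or_lt with h | h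
          · rw [← h]; simp
          · rcases le_total 1 (q' k a / q k a) with h1 | h1
            · simp [hv, h1]
            · simp only [hv, min_eq_right h1]
              refine le_trans (le_of_eq ?_) (le_abs_self _)
              field_simp
  -- Thinning costs at most one nat, because `negMulLog (r * w) = w * negMulLog r + r * negMulLog w`
  -- and `negMulLog w ≤ 1`.
  have hE1 : ∑ u, Real.negMulLog (t u) ≤ ∑ u, Real.negMulLog (r u) + 1 := by
    rw [← hr.1.2, ← Finset.sum_add_distrib]
    refine Finset.sum_le_sum fun u _ => ?_
    simp only [ht]
    rw [Real.negMulLog_mul]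
    have h1 := mul_le_of_le_one_left (Real.negMulLog_nonneg (hr.1.1 u)
      (by rw [← hr.1.2]; exact Finset.single_le_sum (fun i _ => hr.1.1 i) (Finset.mem_univ u)))
      (hw1 u)
    have h2 := mul_le_of_le_one_right (hr.1.1 u) (negMulLog_le_one (w u) (hw0 u))
    linarith
  have hη0 : 0 ≤ η := hδ0.trans hδη
  have hA : 0 ≤ η * (Fintype.card ι * Real.logb 2 (Fintype.card α)) := by
    refine mul_nonneg hη0 (mul_nonneg (Nat.cast_nonneg _) ?_)
    rcases Nat.eq_zero_or_pos (Fintype.card α) with h | h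
    · simp [h]
    · exact Real.logb_nonneg (by norm_num) (by exact_mod_cast h)
  -- If no mass is missing, `t` already couples `q'`; otherwise the residual marginals can be
  -- normalized by `δ`.
  rcases hδ0.eq_or_lt with h | hδpos
  · have hc : IsCoupling q' t := by
      refine ⟨⟨ht0, by linarith⟩, fun k a => ?_⟩
      have h1 : ∑ a, (q' k a - M k a) = 0 := by
        rw [Finset.sum_sub_distrib, hMs, (hq' k).2]; linarith
      have := (Finset.sum_eq_zero_iff_of_nonneg fun a _ => sub_nonneg.2 (hMq k a)).1 h1 a
        (Finset.mem_univ _)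
      simp only [hM] at this
      linarith
    refine ((isLeast_minCouplingEntropy q' hq').2 ⟨t, hc, rfl⟩).trans ?_
    have : entropy t ≤ entropy r + 2 / Real.log 2 := by
      unfold entropy
      rw [← add_div]
      exact div_le_div_of_nonneg_right (by linarith) hlog2.le
    linarith
  -- The missing mass `δ` is filled by any coupling of the normalized residuals. Its entropy is
  -- bounded only by the logarithm of the number of tuples, but it is weighted by `δ ≤ η`; mixing
  -- costs a second nat through `negMulLog δ`.
  · obtain ⟨ρ, hρ⟩ := exists_isCoupling (fun k a => (q' k a - M k a) / δ) (fun k =>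
      ⟨fun a => div_nonneg (sub_nonneg.2 (hMq k a)) hδ0, by
        rw [← Finset.sum_div, Finset.sum_sub_distrib, hMs, (hq' k).2]
        exact div_self hδpos.ne'⟩)
    have hc : IsCoupling q' (fun u => t u + δ * ρ u) := by
      refine ⟨⟨fun u => add_nonneg (ht0 u) (mul_nonneg hδ0 (hρ.1.1 u)), ?_⟩, fun k a => ?_⟩
      · rw [Finset.sum_add_distrib, ← Finset.mul_sum, hρ.1.2]
        rw [hδ]; ring
      · rw [Finset.sum_add_distrib, ← Finset.mul_sum, hρ.2]
        simp only [hM]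
        field_simp
        ring
    refine ((isLeast_minCouplingEntropy q' hq').2 ⟨_, hc, rfl⟩).trans ?_
    have h1 : ∑ u, Real.negMulLog (t u + δ * ρ u)
        ≤ ∑ u, Real.negMulLog (r u) + 1 + (1 + δ * ∑ u, Real.negMulLog (ρ u)) := by
      calc _ ≤ ∑ u, (Real.negMulLog (t u) + Real.negMulLog (δ * ρ u)) :=
            Finset.sum_le_sum fun u _ => negMulLog_add_le (ht0 u) (mul_nonneg hδ0 (hρ.1.1 u))
        _ = ∑ u, Real.negMulLog (t u)
            + (Real.negMulLog δ + δ * ∑ u, Real.negMulLog (ρ u)) := by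
            rw [Finset.sum_add_distrib]
            congr 1
            simp only [Real.negMulLog_mul]
            rw [Finset.sum_add_distrib, ← Finset.sum_mul, hρ.1.2, ← Finset.mul_sum, one_mul]
        _ ≤ _ := by
            have := negMulLog_le_one δ hδ0
            linarith
    have h2 : entropy (fun u => t u + δ * ρ u) ≤ entropy r + 2 / Real.log 2 + δ * entropy ρ := by
      unfold entropy
      rw [← add_div, ← mul_div_assoc, ← add_div]
      exact div_le_div_of_nonneg_right (by linarith) hlog2.le
    have h3 := entropy_le_logb_card hρ.1
    have h5 : Real.logb 2 (Fintype.card (ι → α))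
        = Fintype.card ι * Real.logb 2 (Fintype.card α) := by
      rw [Fintype.card_fun, Nat.cast_pow, Real.logb_pow]
    rw [h5] at h3
    have h4 : δ * entropy ρ ≤ η * (Fintype.card ι * Real.logb 2 (Fintype.card α)) := by
      have h6 : 0 ≤ entropy ρ := div_nonneg (Finset.sum_nonneg fun u _ =>
        Real.negMulLog_nonneg (hρ.1.1 u) (by
          rw [← hρ.1.2]; exact Finset.single_le_sum (fun i _ => hρ.1.1 i) (Finset.mem_univ u)))
          hlog2.le
      exact mul_le_mul hδη h3 h6 hη0
    linarith

end Coupling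

/-! ### Balls in bins by counting maps -/

section Balls

open scoped Classical

variable {ι β : Type*} [Fintype ι] [Fintype β]

/-- Counting maps by their restrictions to a set of arguments and to its complement. -/
lemma card_filter_le_sum_restrict [DecidableEq ι] (p : ι → Prop) (P : (ι → β) → Prop)
    (Q : ({i // p i} → β) → ({i // ¬ p i} → β) → Prop)
    [DecidablePred P] [∀ b, DecidablePred fun a => Q a b]
    (h : ∀ f, P f → Q (fun i => f i) (fun i => f i)) :
    (Finset.univ.filter P).card ≤ ∑ b, (Finset.univ.filter fun a => Q a b).card := by
  have h1 : (Finset.univ.filter P).card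
      ≤ (Finset.univ.filter fun ba : ({i // ¬ p i} → β) × ({i // p i} → β) =>
          Q ba.2 ba.1).card := by
    refine Finset.card_le_card_of_injOn
      (fun f => ((fun i => f i), (fun i => f i))) ?_ ?_
    · intro f hf
      simpa using h f (by simpa using hf)
    · intro f _ f' _ hff
      simp only [Prod.mk.injEq] at hff
      funext i
      by_cases hi : p i
      · exact congrFun hff.2 ⟨i, hi⟩
      · exact congrFun hff.1 ⟨i, hi⟩
  refine h1.trans (le_of_eq ?_)
  simp only [Finset.card_filter]
  exact Fintype.sum_prod_type _

lemma card_pow_restrict (p : ι → Prop) :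
    (Fintype.card β : ℝ) ^ Fintype.card {i // ¬ p i} * (Fintype.card β : ℝ) ^ Fintype.card {i // p i}
      = (Fintype.card β : ℝ) ^ Fintype.card ι := by
  rw [← pow_add, add_comm, ← Fintype.card_sum, Fintype.card_congr (Equiv.sumCompl p)]

/-- Conditioning on the values off `p`, in counting form: bad restrictions `b` contribute a
proportion `η'`, and for each good one a proportion at most `η` of the completions remains. -/
lemma card_filter_le_of_restrict [DecidableEq ι] (p : ι → Prop) (P : (ι → β) → Prop)
    (Q : ({i // p i} → β) → ({i // ¬ p i} → β) → Prop)
    [DecidablePred P] [∀ b, DecidablePred fun a => Q a b]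
    (h : ∀ f, P f → Q (fun i => f i) (fun i => f i)) (B : ({i // ¬ p i} → β) → Prop)
    [DecidablePred B] {η η' : ℝ}
    (hη : 0 ≤ η)
    (hB : ((Finset.univ.filter B).card : ℝ)
      ≤ η' * (Fintype.card β : ℝ) ^ Fintype.card {i // ¬ p i})
    (hQ : ∀ b, ¬ B b → ((Finset.univ.filter fun a => Q a b).card : ℝ)
      ≤ η * (Fintype.card β : ℝ) ^ Fintype.card {i // p i}) :
    ((Finset.univ.filter P).card : ℝ) ≤ (η + η') * (Fintype.card β : ℝ) ^ Fintype.card ι := by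
  set X := (Fintype.card β : ℝ) ^ Fintype.card {i // p i} with hX
  have hX0 : 0 ≤ X := by positivity
  calc ((Finset.univ.filter P).card : ℝ)
      ≤ ∑ b, ((Finset.univ.filter fun a => Q a b).card : ℝ) := by
        exact_mod_cast card_filter_le_sum_restrict p P Q h
    _ ≤ ∑ b, (η * X + if B b then X else 0) := by
        refine Finset.sum_le_sum fun b _ => ?_
        by_cases hb : B b
        · rw [if_pos hb]
          have h1 : ((Finset.univ.filter fun a => Q a b).card : ℝ) ≤ X := by
            refine (Nat.cast_le.2 (Finset.card_le_univ _)).trans (le_of_eq ?_)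
            rw [Fintype.card_fun, Nat.cast_pow]
          nlinarith [mul_nonneg hη hX0]
        · rw [if_neg hb, add_zero]
          exact hQ b hb
    _ = η * ((Fintype.card β : ℝ) ^ Fintype.card {i // ¬ p i} * X)
          + (Finset.univ.filter B).card * X := by
        rw [Finset.sum_add_distrib, ← Finset.sum_filter]
        simp only [Finset.sum_const, nsmul_eq_mul, Finset.card_univ, Fintype.card_fun]
        push_cast
        ring
    _ ≤ _ := by
        have := mul_le_mul_of_nonneg_right hB hX0
        rw [hX, mul_assoc, card_pow_restrict p] at this
        rw [hX, card_pow_restrict p]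
        linarith

/-- It is unlikely that a random map takes at most `a` values in a large set. -/
lemma card_filter_card_image_le (a : ℕ) (Y : Finset β) (haY : a ≤ Y.card) {γ : ℝ}
    (hγ : γ * Fintype.card β ≤ Fintype.card ι) :
    ((Finset.univ.filter fun g : ι → β => (Y.filter fun y => ∃ i, g i = y).card ≤ a).card : ℝ)
      ≤ (Y.card : ℝ) ^ a * Real.exp (-(γ * (Y.card - a)))
          * (Fintype.card β : ℝ) ^ Fintype.card ι := by
  -- Enlarge the set of values hit in `Y` to a set `B ⊆ Y` of exactly `a` elements; then `g` avoids
  -- `Y \ B`. A union bound over `B` costs at most `|Y| ^ a`.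
  have hsub : (Finset.univ.filter fun g : ι → β => (Y.filter fun y => ∃ i, g i = y).card ≤ a)
      ⊆ (Y.powersetCard a).biUnion fun B => Fintype.piFinset fun _ : ι => (Y \ B)ᶜ := by
    intro g hg
    obtain ⟨B, hB1, hB2, hB3⟩ := Finset.exists_subsuperset_card_eq
      (Finset.filter_subset (fun y => ∃ i, g i = y) Y) (by simpa using hg) haY
    refine Finset.mem_biUnion.2 ⟨B, Finset.mem_powersetCard.2 ⟨hB2, hB3⟩, ?_⟩
    rw [Fintype.mem_piFinset]
    intro i
    rw [Finset.mem_compl, Finset.mem_sdiff]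
    rintro ⟨h1, h2⟩
    exact h2 (hB1 (Finset.mem_filter.2 ⟨h1, i, rfl⟩))
  have h1 : (((Y.powersetCard a).biUnion fun B =>
      Fintype.piFinset fun _ : ι => (Y \ B)ᶜ).card : ℝ)
        ≤ (Y.card : ℝ) ^ a * (Real.exp (-(γ * (Y.card - a)))
          * (Fintype.card β : ℝ) ^ Fintype.card ι) := by
    refine (Nat.cast_le.2 Finset.card_biUnion_le).trans ?_
    rw [Nat.cast_sum]
    have h2 : ∀ B ∈ Y.powersetCard a, ((Fintype.piFinset fun _ : ι => (Y \ B)ᶜ).card : ℝ)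
        ≤ Real.exp (-(γ * (Y.card - a))) * (Fintype.card β : ℝ) ^ Fintype.card ι := by
      intro B hB
      rw [Finset.mem_powersetCard] at hB
      have hc : (((Y \ B)ᶜ.card : ℕ) : ℝ) = Fintype.card β - (Y.card - a) := by
        rw [Finset.card_compl, Nat.cast_sub (Finset.card_le_univ _),
          Finset.card_sdiff_of_subset hB.1, Nat.cast_sub (Finset.card_le_card hB.1), hB.2]
      rw [Fintype.card_piFinset, Finset.prod_const, Finset.card_univ, Nat.cast_pow]
      have hd : (0 : ℝ) ≤ Y.card - a := by
        rw [sub_nonneg]; exact_mod_cast haY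
      rcases Nat.eq_zero_or_pos (Fintype.card β) with h0 | h0
      · have hY : Y.card = 0 := Nat.le_zero.1 (h0 ▸ Finset.card_le_univ Y)
        have ha0 : a = 0 := by omega
        rw [hc, h0, hY, ha0]
        simp
      have hn : (0 : ℝ) < Fintype.card β := by exact_mod_cast h0
      have h3 : (((Y \ B)ᶜ.card : ℕ) : ℝ)
          ≤ Fintype.card β * Real.exp (-((Y.card - a) / Fintype.card β)) := by
        have := Real.add_one_le_exp (-(((Y.card : ℝ) - a) / Fintype.card β))
        calc (((Y \ B)ᶜ.card : ℕ) : ℝ)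
            = Fintype.card β * (-(((Y.card : ℝ) - a) / Fintype.card β) + 1) := by
              rw [hc]; field_simp; ring
          _ ≤ _ := mul_le_mul_of_nonneg_left this hn.le
      refine (pow_le_pow_left₀ (Nat.cast_nonneg _) h3 _).trans ?_
      rw [mul_pow, ← Real.exp_nat_mul, mul_comm]
      refine mul_le_mul_of_nonneg_right (Real.exp_le_exp.2 ?_) (by positivity)
      have : γ ≤ Fintype.card ι / Fintype.card β := (le_div_iff₀ hn).2 hγ
      have := mul_le_mul_of_nonneg_right this hd
      rw [mul_neg, neg_le_neg_iff]
      refine this.trans (le_of_eq ?_)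
      ring
    refine (Finset.sum_le_sum h2).trans ?_
    rw [Finset.sum_const, nsmul_eq_mul, Finset.card_powersetCard]
    refine mul_le_mul_of_nonneg_right ?_ (by positivity)
    exact_mod_cast Nat.choose_le_pow _ _
  refine (Nat.cast_le.2 (Finset.card_le_card hsub)).trans (h1.trans (le_of_eq ?_))
  ring

/-- In a random map, some element of a large set has many preimages with high probability. -/
lemma exists_card_filter_fiber_lt_le (K : ℕ) : ∀ η γ : ℝ, 0 < η → 0 < γ → ∃ A : ℕ,
    ∀ (ι β : Type) [Fintype ι] [Fintype β], γ * Fintype.card β ≤ Fintype.card ι →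
      ∀ Y : Finset β, A ≤ Y.card →
      ((Finset.univ.filter fun g : ι → β =>
          ∀ y ∈ Y, (Finset.univ.filter fun i => g i = y).card < K).card : ℝ)
        ≤ η * (Fintype.card β : ℝ) ^ Fintype.card ι := by
  induction K with
  | zero =>
    intro η γ hη _
    refine ⟨1, fun ι β _ _ _ Y hY => ?_⟩
    obtain ⟨y, hy⟩ := Finset.card_pos.1 hY
    rw [Finset.filter_false_of_mem (fun g _ h => absurd (h y hy) (Nat.not_lt_zero _))]
    simp only [Finset.card_empty, Nat.cast_zero]
    positivity
  | succ K ih =>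
    intro η γ hη hγ
    -- The balls are split into two halves. One half hits more than `a` bins of `Y`; by induction
    -- the other puts `K` balls into one of these bins, which makes `K + 1`. The factor `4`, rather
    -- than `2`, absorbs the rounding in the halving.
    obtain ⟨a, ha⟩ := ih (η / 2) (γ / 4) (by positivity) (by positivity)
    have hlim : Filter.Tendsto (fun s : ℕ => (s : ℝ) ^ a * Real.exp (-(γ / 4 * (s - a))))
        Filter.atTop (nhds 0) := by
      have h1 := ((Real.tendsto_pow_mul_exp_neg_atTop_nhds_zero a).comp
        (tendsto_natCast_atTop_atTop.const_mul_atTop (show 0 < γ / 4 by positivity))).const_mul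
          (Real.exp (γ / 4 * a) / (γ / 4) ^ a)
      rw [mul_zero] at h1
      refine h1.congr fun s => ?_
      have h2 : Real.exp (-(γ / 4 * (s - a))) = Real.exp (γ / 4 * a) * Real.exp (-(γ / 4 * s)) := by
        rw [← Real.exp_add]; ring_nf
      simp only [Function.comp_apply, h2, mul_pow]
      field_simp
    obtain ⟨A, hA⟩ := Filter.eventually_atTop.1
      ((hlim.eventually_lt_const (show (0 : ℝ) < η / 2 by positivity)).and
        ((Filter.eventually_ge_atTop a).and (Filter.eventually_ge_atTop ⌈2 / γ⌉₊)))
    refine ⟨A, fun ι β _ _ hcard Y hY => ?_⟩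
    obtain ⟨hA1, hA2, hA3⟩ := hA Y.card hY
    have hbig : 2 ≤ γ * Fintype.card β := by
      have h1 : 2 / γ ≤ Fintype.card β :=
        (Nat.le_ceil _).trans (by exact_mod_cast hA3.trans (Finset.card_le_univ Y))
      rw [div_le_iff₀ hγ] at h1
      linarith
    have hM : 2 ≤ Fintype.card ι := by exact_mod_cast hbig.trans hcard
    obtain ⟨p, hc1⟩ : ∃ p : ι → Prop, Fintype.card {i // p i} = Fintype.card ι / 2 := by
      obtain ⟨J, -, hJ⟩ := Finset.exists_subset_card_eq
        (s := (Finset.univ : Finset ι)) (n := Fintype.card ι / 2)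
        (by rw [Finset.card_univ]; omega)
      refine ⟨fun i => i ∈ J, ?_⟩
      rw [Fintype.card_subtype, ← hJ]
      simp
    have hc2 : Fintype.card {i // ¬ p i} = Fintype.card ι - Fintype.card ι / 2 := by
      rw [Fintype.card_subtype_compl, hc1]
    have hq1 : γ / 4 * Fintype.card β ≤ (Fintype.card ι / 2 : ℕ) := by
      have : (Fintype.card ι : ℝ) ≤ 4 * (Fintype.card ι / 2 : ℕ) := by
        exact_mod_cast (by omega : Fintype.card ι ≤ 4 * (Fintype.card ι / 2))
      linarith
    have hq2 : γ / 4 * Fintype.card β ≤ (Fintype.card ι - Fintype.card ι / 2 : ℕ) :=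
      by
      have h3 : Fintype.card ι / 2 ≤ Fintype.card ι - Fintype.card ι / 2 := by omega
      have h4 : ((Fintype.card ι / 2 : ℕ) : ℝ) ≤ ((Fintype.card ι - Fintype.card ι / 2 : ℕ) : ℝ) :=
        Nat.cast_le.2 h3
      exact hq1.trans h4
    rw [show η = η / 2 + η / 2 by ring]
    refine card_filter_le_of_restrict p
      (fun g : ι → β => ∀ y ∈ Y, (Finset.univ.filter fun i => g i = y).card < K + 1)
      (fun (g : {i // p i} → β) (b : {i // ¬ p i} → β) => ∀ y ∈ Y.filter (fun y => ∃ i, b i = y),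
        (Finset.univ.filter fun i => g i = y).card < K) ?_
      (fun b => (Y.filter fun y => ∃ i, b i = y).card ≤ a) (half_pos hη).le ?_ ?_
    · intro f hf y hy
      rw [Finset.mem_filter] at hy
      obtain ⟨hy1, i, hi⟩ := hy
      -- The inclusion is strict: the ball `i` from the other half also lands in `y`.
      have h1 : ((Finset.univ.filter fun i : {i // p i} => f i = y).map
          (Function.Embedding.subtype _)) ⊂ Finset.univ.filter fun i => f i = y := by
        refine (Finset.ssubset_iff_of_subset ?_).2 ⟨i, ?_, ?_⟩
        · intro j hj
          simp only [Finset.mem_map, Finset.mem_filter, Finset.mem_univ, true_and] at hj ⊢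
          obtain ⟨k, hk, rfl⟩ := hj
          exact hk
        · simpa using hi
        · simp only [Finset.mem_map, not_exists, not_and]
          rintro j - hj
          exact i.2 (hj ▸ j.2)
      have h2 := Finset.card_lt_card h1
      rw [Finset.card_map] at h2
      have := hf y hy1
      change (Finset.univ.filter fun i : {i // p i} => f i = y).card < K
      omega
    · have h5 := card_filter_card_image_le (ι := {i // ¬ p i}) a Y hA2 (γ := γ / 4)
        (by rw [hc2]; exact hq2)
      have h6 := mul_le_mul_of_nonneg_right hA1.le
        (show 0 ≤ (Fintype.card β : ℝ) ^ Fintype.card {i // ¬ p i} by positivity)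
      refine le_trans (le_of_eq ?_) (le_trans h5 h6)
      congr!
    · intro b hb
      convert ha {i // p i} β (by rw [hc1]; exact hq1) _ (not_le.1 hb).le

end Balls

/-! ### The uniform law on the simplex -/

/-- The simplex lies in the image of a cube under the Lipschitz map that restores the first
coordinate from the others. -/
lemma hausdorffMeasure_stdSimplex_lt_top (k : ℕ) :
    (Measure.hausdorffMeasure (k : ℝ) : Measure (Fin (k + 1) → ℝ))
      (stdSimplex ℝ (Fin (k + 1))) < ∞ := by
  set φ : (Fin k → ℝ) → (Fin (k + 1) → ℝ) := fun z => Fin.cons (1 - ∑ i, z i) z with hφ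
  have hL : LipschitzWith (k + 1) φ := by
    refine LipschitzWith.of_dist_le_mul fun z z' => ?_
    have h0 : 0 ≤ dist z z' := dist_nonneg
    refine (dist_pi_le_iff (by positivity)).2 fun i => ?_
    push_cast
    refine Fin.cases ?_ (fun j => ?_) i
    · simp only [hφ, Fin.cons_zero, Real.dist_eq]
      rw [show 1 - ∑ i, z i - (1 - ∑ i, z' i) = ∑ i, (z' i - z i) by
        rw [Finset.sum_sub_distrib]; ring]
      refine (Finset.abs_sum_le_sum_abs _ _).trans ?_
      have : ∀ i ∈ (Finset.univ : Finset (Fin k)), |z' i - z i| ≤ dist z z' := fun i _ => by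
        rw [abs_sub_comm]; exact dist_le_pi_dist z z' i
      refine (Finset.sum_le_sum this).trans ?_
      simp only [Finset.sum_const, Finset.card_univ, Fintype.card_fin, nsmul_eq_mul]
      nlinarith
    · simp only [hφ, Fin.cons_succ]
      have := dist_le_pi_dist z z' j
      have : 0 ≤ (k : ℝ) * dist z z' := by positivity
      linarith
  have hsub : stdSimplex ℝ (Fin (k + 1)) ⊆ φ '' Set.Icc 0 1 := by
    intro p hp
    refine ⟨Fin.tail p, ⟨fun i => hp.1 _, fun i => ?_⟩, ?_⟩
    · exact (Finset.single_le_sum (f := p) (fun i _ => hp.1 i) (Finset.mem_univ i.succ)).trans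
        hp.2.le
    · have : p 0 = 1 - ∑ i, Fin.tail p i := by
        have := hp.2
        rw [Fin.sum_univ_succ] at this
        simp only [Fin.tail]
        linarith
      simp only [hφ]
      rw [← this, Fin.cons_self_tail]
  refine (measure_mono hsub).trans_lt
    ((hL.hausdorffMeasure_image_le (Nat.cast_nonneg k) _).trans_lt ?_)
  refine ENNReal.mul_lt_top (ENNReal.rpow_lt_top_of_nonneg (Nat.cast_nonneg k) ENNReal.coe_ne_top) ?_
  have h := hausdorffMeasure_pi_real (ι := Fin k)
  rw [Fintype.card_fin] at h
  rw [h]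
  exact isCompact_Icc.measure_lt_top

/-- Dropping the first coordinate is 1-Lipschitz, and the projected simplex contains a cube of side
`1 / (k + 1)`. -/
lemma hausdorffMeasure_stdSimplex_pos (k : ℕ) :
    0 < (Measure.hausdorffMeasure (k : ℝ) : Measure (Fin (k + 1) → ℝ))
      (stdSimplex ℝ (Fin (k + 1))) := by
  have hL : LipschitzWith 1 (Fin.tail : (Fin (k + 1) → ℝ) → (Fin k → ℝ)) := by
    refine LipschitzWith.of_dist_le_mul fun z z' => ?_
    rw [NNReal.coe_one, one_mul]
    exact (dist_pi_le_iff dist_nonneg).2 fun i => dist_le_pi_dist z z' i.succ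
  have hsub : Set.Icc (0 : Fin k → ℝ) (fun _ => 1 / (k + 1))
      ⊆ Fin.tail '' stdSimplex ℝ (Fin (k + 1)) := by
    intro z hz
    have h1 : ∑ i, z i ≤ 1 := by
      refine (Finset.sum_le_sum fun i _ => hz.2 i).trans ?_
      simp only [Finset.sum_const, Finset.card_univ, Fintype.card_fin, nsmul_eq_mul]
      rw [mul_one_div, div_le_one (by positivity)]
      linarith
    refine ⟨Fin.cons (1 - ∑ i, z i) z, ⟨fun i => ?_, ?_⟩, Fin.tail_cons _ _⟩
    · refine Fin.cases ?_ (fun j => ?_) i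
      · simpa using h1
      · simpa using hz.1 j
    · rw [Fin.sum_univ_succ]
      simp
  have h := hausdorffMeasure_pi_real (ι := Fin k)
  rw [Fintype.card_fin] at h
  have h2 := hL.hausdorffMeasure_image_le (Nat.cast_nonneg k) (stdSimplex ℝ (Fin (k + 1)))
  rw [h, ENNReal.coe_one, ENNReal.one_rpow, one_mul] at h2
  refine lt_of_lt_of_le ?_ ((measure_mono hsub).trans h2)
  rw [Real.volume_Icc_pi]
  rw [pos_iff_ne_zero, Finset.prod_ne_zero_iff]
  intro i _
  simp only [Pi.zero_apply, sub_zero]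
  exact (ENNReal.ofReal_pos.2 (by positivity)).ne'

lemma simplexUniform_eq (k : ℕ) : simplexUniform (k + 1)
    = ProbabilityTheory.cond (Measure.hausdorffMeasure (k : ℝ)) (stdSimplex ℝ (Fin (k + 1))) := by
  unfold simplexUniform
  congr 2
  push_cast
  ring

lemma measurableSet_stdSimplex (n : ℕ) : MeasurableSet (stdSimplex ℝ (Fin n)) :=
  (isClosed_stdSimplex ℝ (Fin n)).measurableSet

instance isProbabilityMeasure_simplexUniform (k : ℕ) :
    IsProbabilityMeasure (simplexUniform (k + 1)) := by
  rw [simplexUniform_eq]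
  exact cond_isProbabilityMeasure_of_finite (hausdorffMeasure_stdSimplex_pos k).ne'
    (hausdorffMeasure_stdSimplex_lt_top k).ne

lemma ae_mem_stdSimplex (k : ℕ) : ∀ᵐ p ∂simplexUniform (k + 1), p ∈ stdSimplex ℝ (Fin (k + 1)) := by
  rw [simplexUniform_eq]
  exact ae_cond_mem (measurableSet_stdSimplex _)

/-- The homothety of ratio `1 - t` centred at the vertex `i` maps the simplex into its part where `t
≤ p i`, and scales `k`-dimensional measure by `(1 - t) ^ k`. No density has to be computed. -/
lemma simplexUniform_le_coord (k : ℕ) (i : Fin (k + 1)) {t : ℝ} (ht0 : 0 ≤ t) (ht1 : t < 1) :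
    ENNReal.ofReal ((1 - t) ^ k) ≤ simplexUniform (k + 1) {p | t ≤ p i} := by
  have h1t : (0 : ℝ) < 1 - t := by linarith
  have hsub : AffineMap.homothety (Pi.single i 1 : Fin (k + 1) → ℝ) (1 - t)
      '' stdSimplex ℝ (Fin (k + 1)) ⊆ stdSimplex ℝ (Fin (k + 1)) ∩ {p | t ≤ p i} := by
    rintro _ ⟨p, hp, rfl⟩
    have hval : ∀ j, AffineMap.homothety (Pi.single i 1 : Fin (k + 1) → ℝ) (1 - t) p j
        = (1 - t) * p j + t * (Pi.single i 1 : Fin (k + 1) → ℝ) j := by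
      intro j
      simp only [AffineMap.homothety_apply, vsub_eq_sub, vadd_eq_add, Pi.add_apply, Pi.smul_apply,
        Pi.sub_apply, smul_eq_mul]
      ring
    refine ⟨⟨fun j => ?_, ?_⟩, ?_⟩
    · rw [hval]
      refine add_nonneg (mul_nonneg h1t.le (hp.1 j)) (mul_nonneg ht0 ?_)
      rcases eq_or_ne j i with rfl | h
      · simp
      · simp [h]
    · simp only [hval]
      rw [Finset.sum_add_distrib, ← Finset.mul_sum, ← Finset.mul_sum, hp.2]
      simp
    · simp only [Set.mem_ofPred_eq, hval, Pi.single_eq_same]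
      nlinarith [mul_nonneg h1t.le (hp.1 i)]
  have hm := measure_mono (μ := Measure.hausdorffMeasure (k : ℝ)) hsub
  rw [hausdorffMeasure_homothety_image (Nat.cast_nonneg k) _ h1t.ne'] at hm
  rw [simplexUniform_eq, cond_apply (measurableSet_stdSimplex _)]
  have hpos := hausdorffMeasure_stdSimplex_pos k
  have hfin := hausdorffMeasure_stdSimplex_lt_top k
  refine le_trans (le_of_eq ?_) (mul_le_mul_right hm _)
  rw [ENNReal.smul_def, smul_eq_mul, mul_left_comm, ENNReal.inv_mul_cancel hpos.ne' hfin.ne, mul_one,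
    NNReal.rpow_natCast, ENNReal.ofReal, Real.toNNReal_pow h1t.le]
  congr 2
  rw [← Real.toNNReal_eq_nnnorm_of_nonneg h1t.le]

lemma simplexUniform_coord_lt (k : ℕ) (i : Fin (k + 1)) {t : ℝ} (ht0 : 0 ≤ t) :
    (simplexUniform (k + 1)).real {p | p i < t} ≤ (k + 1) * t := by
  have hk : (0 : ℝ) ≤ k := Nat.cast_nonneg k
  rcases lt_or_ge t 1 with ht1 | ht1
  · have h := simplexUniform_le_coord k i ht0 ht1
    have hm : MeasurableSet {p : Fin (k + 1) → ℝ | t ≤ p i} :=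
      measurableSet_le measurable_const (measurable_pi_apply i)
    have h2 : {p : Fin (k + 1) → ℝ | p i < t} = {p | t ≤ p i}ᶜ := by ext; simp
    rw [h2, probReal_compl_eq_one_sub hm]
    have h3 : (1 - t) ^ k ≤ (simplexUniform (k + 1)).real {p | t ≤ p i} :=
      (ENNReal.ofReal_le_iff_le_toReal (measure_ne_top _ _)).1 h
    have h4 := one_add_mul_le_pow (show -2 ≤ -t by linarith) k
    rw [← sub_eq_add_neg] at h4
    linarith
  · exact measureReal_le_one.trans (by nlinarith)

/-- The input distributions without very small probabilities and with many probabilities of order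
`1 / n`. -/
def spreadInputs (n : ℕ) (δ a : ℝ) : Set (Fin n → ℝ) :=
  {p | p ∈ stdSimplex ℝ (Fin n) ∧ (∀ i, δ / n ^ 2 ≤ p i) ∧
    (n : ℝ) / 2 ≤ (Finset.univ.filter fun i => a / n ≤ p i ∧ p i ≤ 4 / n).card}

/-- A union bound over coordinates gives the `δ`. Markov's inequality makes at least `n / 4`
coordinates fall below `a / n` with probability at most `4 * a`, and at most `n / 4` can exceed `4 /
n` as they sum to `1`; this leaves half of them in between. -/
lemma simplexUniform_compl_spreadInputs_le (k : ℕ) {δ a : ℝ} (hδ : 0 ≤ δ) (ha : 0 ≤ a) :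
    (simplexUniform (k + 1)).real (spreadInputs (k + 1) δ a)ᶜ ≤ δ + 4 * a := by
  set n : ℕ := k + 1 with hn
  have hncast : (n : ℝ) = k + 1 := by rw [hn]; push_cast; rfl
  have hnpos : (0 : ℝ) < n := by rw [hncast]; positivity
  set μ := simplexUniform n with hμ
  have hprob : IsProbabilityMeasure μ := isProbabilityMeasure_simplexUniform k
  set W : (Fin n → ℝ) → ℝ := fun p => ∑ i, Set.indicator {p | p i < a / n} (fun _ => (1 : ℝ)) p
    with hW
  have hmeas : ∀ i, MeasurableSet {p : Fin n → ℝ | p i < a / n} := fun i =>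
    measurableSet_lt (measurable_pi_apply i) measurable_const
  have hWcard : ∀ p, W p = (Finset.univ.filter fun i => p i < a / n).card := by
    intro p
    simp only [hW, Set.indicator_apply, Set.mem_ofPred_eq, Finset.card_filter]
    push_cast
    rfl
  have hint : ∀ i, Integrable (Set.indicator {p : Fin n → ℝ | p i < a / n} fun _ => (1 : ℝ)) μ :=
    fun i => (integrable_const 1).indicator (hmeas i)
  have hEW : ∫ p, W p ∂μ ≤ n * a := by
    simp only [hW]
    rw [integral_finsetSum _ fun i _ => hint i]
    have : ∀ i ∈ Finset.univ, ∫ p, Set.indicator {p : Fin n → ℝ | p i < a / n}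
        (fun _ => (1 : ℝ)) p ∂μ ≤ a := by
      intro i _
      rw [integral_indicator (hmeas i), setIntegral_const, smul_eq_mul, mul_one]
      refine (simplexUniform_coord_lt k i (by positivity)).trans (le_of_eq ?_)
      rw [← hncast]
      field_simp
    refine (Finset.sum_le_sum this).trans ?_
    simp
  have hMarkov : μ.real {p | (n : ℝ) / 4 ≤ W p} ≤ 4 * a := by
    have h := mul_meas_ge_le_integral_of_nonneg (μ := μ) (f := W)
      (Filter.Eventually.of_forall fun p => by rw [hWcard]; exact Nat.cast_nonneg _)
      (integrable_finsetSum _ fun i _ => hint i) ((n : ℝ) / 4)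
    have h2 := h.trans hEW
    rw [← mul_le_mul_iff_right₀ hnpos]
    linarith
  have hmin : μ.real (⋃ i, {p | p i < δ / n ^ 2}) ≤ δ := by
    refine (measureReal_iUnion_fintype_le _).trans ?_
    have : ∀ i ∈ Finset.univ, μ.real {p : Fin n → ℝ | p i < δ / n ^ 2} ≤ δ / n := by
      intro i _
      refine (simplexUniform_coord_lt k i (by positivity)).trans (le_of_eq ?_)
      rw [← hncast]
      field_simp
    refine (Finset.sum_le_sum this).trans (le_of_eq ?_)
    simp only [Finset.sum_const, Finset.card_univ, Fintype.card_fin, nsmul_eq_mul]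
    field_simp
  have hnull : μ.real (stdSimplex ℝ (Fin n))ᶜ = 0 := by
    have h0 : μ (stdSimplex ℝ (Fin n))ᶜ = 0 := ae_mem_stdSimplex k
    rw [Measure.real, h0, ENNReal.toReal_zero]
  have hsub : (spreadInputs n δ a)ᶜ ⊆ (stdSimplex ℝ (Fin n))ᶜ ∪
      ((⋃ i, {p | p i < δ / n ^ 2}) ∪ {p | (n : ℝ) / 4 ≤ W p}) := by
    intro p hp
    by_contra hcon
    simp only [Set.mem_union, Set.mem_compl_iff, not_or, not_not, Set.mem_iUnion, Set.mem_ofPred_eq,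
      not_exists, not_lt, not_le] at hcon
    obtain ⟨h1, h2, h3⟩ := hcon
    refine hp ⟨h1, h2, ?_⟩
    rw [hWcard] at h3
    have h4 : ((Finset.univ.filter fun i => 4 / n < p i).card : ℝ) ≤ n / 4 := by
      have h5 : ∑ i ∈ Finset.univ.filter (fun i => 4 / n < p i), (4 / n : ℝ) ≤ 1 := by
        rw [← h1.2]
        refine (Finset.sum_le_sum fun i hi => (Finset.mem_filter.1 hi).2.le).trans ?_
        exact Finset.sum_le_sum_of_subset_of_nonneg (Finset.filter_subset _ _) fun i _ _ => h1.1 i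
      rw [Finset.sum_const, nsmul_eq_mul, mul_div_assoc', div_le_one hnpos] at h5
      linarith
    have h6 : n ≤ (Finset.univ.filter fun i => a / n ≤ p i ∧ p i ≤ 4 / n).card
        + ((Finset.univ.filter fun i => p i < a / n).card
          + (Finset.univ.filter fun i => 4 / n < p i).card) := by
      calc n = (Finset.univ : Finset (Fin n)).card := by simp
        _ ≤ _ := by
          refine (Finset.card_le_card ?_).trans ((Finset.card_union_le _ _).trans
            (Nat.add_le_add_left (Finset.card_union_le _ _) _))
          intro i _
          simp only [Finset.mem_union, Finset.mem_filter, Finset.mem_univ, true_and]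
          rcases lt_or_ge (p i) (a / n) with h | h
          · exact Or.inr (Or.inl h)
          · rcases lt_or_ge (4 / (n : ℝ)) (p i) with h' | h'
            · exact Or.inr (Or.inr h')
            · exact Or.inl ⟨h, h'⟩
    have h7 : (n : ℝ) ≤ (Finset.univ.filter fun i => a / n ≤ p i ∧ p i ≤ 4 / n).card
        + ((Finset.univ.filter fun i => p i < a / n).card
          + (Finset.univ.filter fun i => 4 / n < p i).card) := by exact_mod_cast h6
    linarith
  have := measureReal_mono (μ := μ) hsub
  have h8 := measureReal_union_le (μ := μ) (stdSimplex ℝ (Fin n))ᶜ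
    ((⋃ i, {p | p i < δ / n ^ 2}) ∪ {p | (n : ℝ) / 4 ≤ W p})
  have h9 := measureReal_union_le (μ := μ) (⋃ i, {p | p i < δ / n ^ 2}) {p | (n : ℝ) / 4 ≤ W p}
  linarith

/-! ### The law of the data -/

lemma lintegral_le_add_of_le {α : Type*} [MeasurableSpace α] (μ : Measure α)
    [IsProbabilityMeasure μ] (F : α → ℝ≥0∞) (S : Set α) (c : ℝ≥0∞) (h1 : ∀ x, F x ≤ 1)
    (h2 : ∀ x, x ∉ S → F x ≤ c) : ∫⁻ x, F x ∂μ ≤ μ S + c := by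
  -- The measurable hull of `S` is used since neither `S` nor `F` is assumed measurable.
  calc ∫⁻ x, F x ∂μ ≤ ∫⁻ x, (Set.indicator (toMeasurable μ S) 1 x + c) ∂μ := by
        refine lintegral_mono fun x => ?_
        by_cases hx : x ∈ toMeasurable μ S
        · rw [Set.indicator_of_mem hx]
          exact (h1 x).trans le_self_add
        · exact (h2 x fun h => hx (subset_toMeasurable μ S h)).trans le_add_self
    _ = μ S + c := by
        rw [lintegral_add_right _ measurable_const,
          lintegral_indicator_one (measurableSet_toMeasurable μ S), measure_toMeasurable]
        simp

section Law

lemma finiteLaw_apply {α : Type*} [Fintype α] [MeasurableSpace α] (p : α → ℝ) {s : Set α}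
    (hs : MeasurableSet s) :
    finiteLaw p s = ∑ a, ENNReal.ofReal (p a) * s.indicator 1 a := by
  simp [finiteLaw, Measure.dirac_apply' _ hs]

lemma isProbabilityMeasure_finiteLaw {α : Type*} [Fintype α] [MeasurableSpace α] {p : α → ℝ}
    (hp : p ∈ stdSimplex ℝ α) : IsProbabilityMeasure (finiteLaw p) := by
  constructor
  rw [finiteLaw_apply p MeasurableSet.univ]
  simp only [Set.indicator_univ, Pi.one_apply, mul_one]
  rw [← ENNReal.ofReal_sum_of_nonneg fun a _ => hp.1 a, hp.2, ENNReal.ofReal_one]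

instance isFiniteMeasure_finiteLaw {α : Type*} [Fintype α] [MeasurableSpace α] (p : α → ℝ) :
    IsFiniteMeasure (finiteLaw p) := by
  constructor
  rw [finiteLaw_apply p MeasurableSet.univ]
  simp only [Set.indicator_univ, Pi.one_apply, mul_one]
  exact ENNReal.sum_lt_top.2 fun a _ => ENNReal.ofReal_lt_top

variable {n m : ℕ}

/-- The joint probabilities of `(X, Y)` in the structural causal model. -/
def scmJoint (p : Fin n → ℝ) (pE : Fin m → ℝ) (f : Fin n × Fin m → Fin n) (x y : Fin n) : ℝ :=
  p x * ∑ e with f (x, e) = y, pE e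

lemma scmLaw_singleton (p : Fin n → ℝ) {pE : Fin m → ℝ} (hE : ∀ e, 0 ≤ pE e)
    (f : Fin n × Fin m → Fin n) (xy : Fin n × Fin n) :
    scmLaw p pE f {xy}
      = ENNReal.ofReal (p xy.1) * ENNReal.ofReal (∑ e with f (xy.1, e) = xy.2, pE e) := by
  have h : (fun xe : Fin n × Fin m => (xe.1, f xe)) ⁻¹' {xy}
      = ({xy.1} : Set (Fin n)) ×ˢ {e | f (xy.1, e) = xy.2} := by
    ext ⟨x, e⟩
    simp only [Set.mem_preimage, Set.mem_singleton_iff, Set.mem_prod, Set.mem_ofPred_eq, Prod.ext_iff]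
    constructor
    · rintro ⟨rfl, h⟩; exact ⟨rfl, h⟩
    · rintro ⟨rfl, h⟩; exact ⟨rfl, h⟩
  rw [scmLaw, Measure.map_apply (measurable_of_countable _) (measurableSet_singleton _), h,
    Measure.prod_prod, finiteLaw_apply _ (measurableSet_singleton _),
    finiteLaw_apply _ (Set.toFinite _).measurableSet]
  congr 1
  · simp [Set.indicator_apply]
  · rw [ENNReal.ofReal_sum_of_nonneg fun e _ => hE e, Finset.sum_filter]
    simp [Set.indicator_apply]

instance isFiniteMeasure_scmLaw (p : Fin n → ℝ) (pE : Fin m → ℝ) (f : Fin n × Fin m → Fin n) :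
    IsFiniteMeasure (scmLaw p pE f) := by
  unfold scmLaw; infer_instance

lemma isProbabilityMeasure_scmLaw {p : Fin n → ℝ} (hp : p ∈ stdSimplex ℝ (Fin n)) {pE : Fin m → ℝ}
    (hE : pE ∈ stdSimplex ℝ (Fin m)) (f : Fin n × Fin m → Fin n) :
    IsProbabilityMeasure (scmLaw p pE f) := by
  have := isProbabilityMeasure_finiteLaw hp
  have := isProbabilityMeasure_finiteLaw hE
  exact Measure.isProbabilityMeasure_map (measurable_of_countable _).aemeasurable

lemma scmLaw_real_singleton {p : Fin n → ℝ} (hp : ∀ x, 0 ≤ p x) {pE : Fin m → ℝ}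
    (hE : ∀ e, 0 ≤ pE e) (f : Fin n × Fin m → Fin n) (x y : Fin n) :
    (scmLaw p pE f).real {(x, y)} = scmJoint p pE f x y := by
  rw [Measure.real, scmLaw_singleton p hE, ← ENNReal.ofReal_mul (hp _),
    ENNReal.toReal_ofReal (mul_nonneg (hp _) (Finset.sum_nonneg fun e _ => hE e))]
  rfl

lemma measurable_pi_scmLaw {pE : Fin m → ℝ} (hE : ∀ e, 0 ≤ pE e) (N : ℕ) :
    Measurable fun θ : (Fin n → ℝ) × (Fin n × Fin m → Fin n) =>
      Measure.pi fun _ : Fin N => scmLaw θ.1 pE θ.2 := by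
  refine Measure.measurable_of_measurable_coe _ fun S _ => ?_
  have h : ∀ θ : (Fin n → ℝ) × (Fin n × Fin m → Fin n),
      (Measure.pi fun _ : Fin N => scmLaw θ.1 pE θ.2) S
        = ∑ s ∈ S.toFinite.toFinset, ∏ i, (ENNReal.ofReal (θ.1 (s i).1)
          * ENNReal.ofReal (∑ e with θ.2 ((s i).1, e) = (s i).2, pE e)) := by
    intro θ
    conv_lhs => rw [← S.toFinite.coe_toFinset]
    rw [← sum_measure_singleton]
    refine Finset.sum_congr rfl fun s _ => ?_
    rw [Measure.pi_singleton]
    exact Finset.prod_congr rfl fun i _ => scmLaw_singleton _ hE _ _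
  simp only [h]
  refine Finset.measurable_fun_sum _ fun s _ => Finset.measurable_fun_prod _ fun i _ => ?_
  have h1 : Measurable fun g : Fin n × Fin m → Fin n =>
      ENNReal.ofReal (∑ e with g ((s i).1, e) = (s i).2, pE e) := measurable_of_countable _
  exact ((measurable_pi_apply _).comp measurable_fst).ennreal_ofReal.mul (h1.comp measurable_snd)

lemma isProbabilityMeasure_uniformOn_univ {α : Type*} [Finite α] [Nonempty α] [MeasurableSpace α]
    [MeasurableSingletonClass α] : IsProbabilityMeasure (uniformOn (Set.univ : Set α)) :=
  isProbabilityMeasure_uniformOn Set.finite_univ Set.univ_nonempty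

lemma dataLaw_apply {k : ℕ} {pE : Fin m → ℝ} (hE : pE ∈ stdSimplex ℝ (Fin m)) (N : ℕ)
    (S : Set (Fin N → Fin (k + 1) × Fin (k + 1))) :
    dataLaw (k + 1) pE N S = ∫⁻ p, ∫⁻ f, (Measure.pi fun _ : Fin N => scmLaw p pE f) S
      ∂uniformOn Set.univ ∂simplexUniform (k + 1) := by
  have := isProbabilityMeasure_uniformOn_univ (α := Fin (k + 1) × Fin m → Fin (k + 1))
  have hmeas := measurable_pi_scmLaw (n := k + 1) hE.1 N
  have hm : Measurable fun θ : (Fin (k + 1) → ℝ) × (Fin (k + 1) × Fin m → Fin (k + 1)) =>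
      (Measure.pi fun _ : Fin N => scmLaw θ.1 pE θ.2) S :=
    (Measure.measurable_coe S.toFinite.measurableSet).comp hmeas
  rw [dataLaw, Measure.bind_apply S.toFinite.measurableSet hmeas.aemeasurable,
    lintegral_prod _ hm.aemeasurable]

/-- Fubini and a union bound: an event of the data is unlikely if it is unlikely for every typical
input distribution and typical mechanism. -/
lemma dataLaw_le {k : ℕ} {pE : Fin m → ℝ} (hE : pE ∈ stdSimplex ℝ (Fin m)) (N : ℕ)
    (S : Set (Fin N → Fin (k + 1) × Fin (k + 1))) (G : Set (Fin (k + 1) → ℝ))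
    (hG : G ⊆ stdSimplex ℝ (Fin (k + 1)))
    (B : (Fin (k + 1) → ℝ) → Set (Fin (k + 1) × Fin m → Fin (k + 1))) (b c : ℝ≥0∞)
    (hB : ∀ p ∈ G, uniformOn Set.univ (B p) ≤ b)
    (hS : ∀ p ∈ G, ∀ f, f ∉ B p → (Measure.pi fun _ : Fin N => scmLaw p pE f) S ≤ c) :
    dataLaw (k + 1) pE N S ≤ simplexUniform (k + 1) Gᶜ + (b + c) := by
  have := isProbabilityMeasure_uniformOn_univ (α := Fin (k + 1) × Fin m → Fin (k + 1))
  rw [dataLaw_apply hE]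
  have hae : ∀ᵐ p ∂simplexUniform (k + 1), p ∈ stdSimplex ℝ (Fin (k + 1)) := ae_mem_stdSimplex k
  set F : (Fin (k + 1) → ℝ) → ℝ≥0∞ := fun p =>
    ∫⁻ f, (Measure.pi fun _ : Fin N => scmLaw p pE f) S ∂uniformOn Set.univ with hF
  have h1 : ∀ p ∈ stdSimplex ℝ (Fin (k + 1)), ∀ f,
      (Measure.pi fun _ : Fin N => scmLaw p pE f) S ≤ 1 := fun p hp f => by
    have := isProbabilityMeasure_scmLaw hp hE f
    exact prob_le_one
  -- Truncation at `1` is needed because `scmLaw` is a probability measure only for `p` in the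
  -- simplex, that is, almost everywhere.
  calc ∫⁻ p, F p ∂simplexUniform (k + 1) ≤ ∫⁻ p, min (F p) 1 ∂simplexUniform (k + 1) := by
        refine lintegral_mono_ae ?_
        filter_upwards [hae] with p hp
        refine le_min le_rfl ?_
        refine (lintegral_mono (h1 p hp)).trans ?_
        simp
    _ ≤ _ := by
        refine lintegral_le_add_of_le _ _ _ _ (fun p => min_le_right _ _) fun p hp => ?_
        have hpG : p ∈ G := not_not.1 hp
        refine (min_le_left _ _).trans ?_
        refine (lintegral_le_add_of_le _ _ (B p) c (h1 p (hG hpG)) (hS p hpG)).trans ?_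
        gcongr
        exact hB p hpG

lemma isProbabilityMeasure_dataLaw {k : ℕ} {pE : Fin m → ℝ} (hE : pE ∈ stdSimplex ℝ (Fin m))
    (N : ℕ) : IsProbabilityMeasure (dataLaw (k + 1) pE N) := by
  have := isProbabilityMeasure_uniformOn_univ (α := Fin (k + 1) × Fin m → Fin (k + 1))
  constructor
  rw [dataLaw_apply hE]
  rw [lintegral_congr_ae (g := fun _ => 1)]
  · simp
  · filter_upwards [ae_mem_stdSimplex k] with p hp
    have : ∀ f, (Measure.pi fun _ : Fin N => scmLaw p pE f) Set.univ = 1 := fun f => by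
      have := isProbabilityMeasure_scmLaw hp hE f
      exact measure_univ
    simp [this]

end Law

/-! ### Sampling error by second moments -/

section Sampling

/-- The mean square error of an empirical frequency. -/
lemma integral_sq_average_sub_le {Ω : Type*} [Finite Ω] [MeasurableSpace Ω]
    [MeasurableSingletonClass Ω] (ν : Measure Ω) [IsProbabilityMeasure ν] (φ : Ω → ℝ)
    (hφ : ∀ ω, φ ω ^ 2 = φ ω) {N : ℕ} (hN : 0 < N) :
    ∫ s, ((∑ i, φ (s i)) / N - ∫ ω, φ ω ∂ν) ^ 2 ∂(Measure.pi fun _ : Fin N => ν)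
      ≤ (∫ ω, φ ω ∂ν) / N := by
  have hN' : (0 : ℝ) < N := by exact_mod_cast hN
  set P := Measure.pi fun _ : Fin N => ν with hP
  set X : (Fin N → Ω) → ℝ := ∑ i, fun s => φ (s i) with hX
  have hXs : ∀ s, X s = ∑ i, φ (s i) := fun s => by simp [hX]
  have hmem : MemLp φ 2 ν := MemLp.of_discrete
  have hmean : ∫ s, X s ∂P = N * ∫ ω, φ ω ∂ν := by
    simp only [hXs]
    rw [integral_finsetSum _ fun i _ => Integrable.of_finite]
    have : ∀ i : Fin N, ∫ s, φ (s i) ∂P = ∫ ω, φ ω ∂ν := fun i =>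
      integral_comp_eval (μ := fun _ : Fin N => ν) (i := i) hmem.1
    simp [this]
  have hvar : Var[X; P] ≤ N * ∫ ω, φ ω ∂ν := by
    rw [hX, variance_sum_pi (X := fun _ => φ) fun _ => hmem]
    have : Var[φ; ν] ≤ ∫ ω, φ ω ∂ν := by
      refine (variance_le_expectation_sq hmem.1).trans (le_of_eq ?_)
      exact integral_congr_ae (Filter.Eventually.of_forall fun ω => hφ ω)
    simp only [Finset.sum_const, Finset.card_univ, Fintype.card_fin, nsmul_eq_mul]
    exact mul_le_mul_of_nonneg_left this hN'.le
  rw [variance_eq_integral (measurable_of_finite X).aemeasurable, hmean] at hvar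
  have : ∀ s, ((∑ i, φ (s i)) / N - ∫ ω, φ ω ∂ν) ^ 2
      = (X s - N * ∫ ω, φ ω ∂ν) ^ 2 / (N : ℝ) ^ 2 := fun s => by
    rw [hXs]; field_simp
  simp only [this]
  rw [integral_div, div_le_div_iff₀ (by positivity) hN']
  nlinarith

end Sampling

section Sampling

variable {n m N : ℕ}

lemma sum_scmJoint (p : Fin n → ℝ) {pE : Fin m → ℝ} (hE : pE ∈ stdSimplex ℝ (Fin m))
    (f : Fin n × Fin m → Fin n) (x : Fin n) : ∑ y, scmJoint p pE f x y = p x := by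
  simp only [scmJoint]
  rw [← Finset.mul_sum, Finset.sum_fiberwise Finset.univ (fun e => f (x, e)) pE, hE.2, mul_one]

lemma sum_empJoint_right (s : Fin N → Fin n × Fin n) (x : Fin n) :
    ∑ y, empJoint s x y = empX s x := by
  simp only [empJoint, empX]
  rw [← Finset.sum_div, Finset.sum_comm]
  congr 1
  refine Finset.sum_congr rfl fun i _ => ?_
  by_cases h : (s i).1 = x <;> simp [h]

lemma sum_empJoint_left (s : Fin N → Fin n × Fin n) (y : Fin n) :
    ∑ x, empJoint s x y = empY s y := by
  simp only [empJoint, empY]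
  rw [← Finset.sum_div, Finset.sum_comm]
  congr 1
  refine Finset.sum_congr rfl fun i _ => ?_
  by_cases h : (s i).2 = y <;> simp [h]

lemma empJoint_nonneg (s : Fin N → Fin n × Fin n) (x y : Fin n) : 0 ≤ empJoint s x y :=
  div_nonneg (Finset.sum_nonneg fun i _ => by split_ifs <;> norm_num) (Nat.cast_nonneg _)

lemma empX_pos (s : Fin N → Fin n × Fin n) {x : Fin n} (hx : x ∈ observedX s) : 0 < empX s x := by
  obtain ⟨i, -, rfl⟩ := Finset.mem_image.1 hx
  have hN : (0 : ℝ) < N := by exact_mod_cast i.pos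
  refine div_pos (Finset.sum_pos' (fun j _ => by split_ifs <;> norm_num)
    ⟨i, Finset.mem_univ i, by simp⟩) hN

lemma empY_pos (s : Fin N → Fin n × Fin n) {y : Fin n} (hy : y ∈ observedY s) : 0 < empY s y := by
  obtain ⟨i, -, rfl⟩ := Finset.mem_image.1 hy
  have hN : (0 : ℝ) < N := by exact_mod_cast i.pos
  refine div_pos (Finset.sum_pos' (fun j _ => by split_ifs <;> norm_num)
    ⟨i, Finset.mem_univ i, by simp⟩) hN

lemma mem_observedY_of_empY_pos (s : Fin N → Fin n × Fin n) {y : Fin n} (hy : 0 < empY s y) :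
    y ∈ observedY s := by
  by_contra h
  have : ∀ i, (s i).2 ≠ y := fun i hi => h (Finset.mem_image.2 ⟨i, Finset.mem_univ i, hi⟩)
  simp [empY, this] at hy

lemma condYgivenX_mem_stdSimplex (s : Fin N → Fin n × Fin n) (x : observedX s) :
    condYgivenX s x ∈ stdSimplex ℝ (Fin n) := by
  have hx := empX_pos s x.2
  refine ⟨fun y => div_nonneg (empJoint_nonneg s _ _) hx.le, ?_⟩
  simp only [condYgivenX]
  rw [← Finset.sum_div, sum_empJoint_right, div_self hx.ne']

lemma condXgivenY_mem_stdSimplex (s : Fin N → Fin n × Fin n) (y : observedY s) :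
    condXgivenY s y ∈ stdSimplex ℝ (Fin n) := by
  have hy := empY_pos s y.2
  refine ⟨fun x => div_nonneg (empJoint_nonneg s _ _) hy.le, ?_⟩
  simp only [condXgivenY]
  rw [← Finset.sum_div, sum_empJoint_left, div_self hy.ne']

/-- The weighted square error of the empirical joint distribution. -/
noncomputable def sqError (p : Fin n → ℝ) (J : Fin n → Fin n → ℝ) (s : Fin N → Fin n × Fin n) : ℝ :=
  ∑ x, ∑ y, (empJoint s x y - J x y) ^ 2 / p x ^ 2

/-- The weighted `ℓ¹` error of the empirical joint distribution. -/
noncomputable def absError (p : Fin n → ℝ) (J : Fin n → Fin n → ℝ) (s : Fin N → Fin n × Fin n) : ℝ :=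
  ∑ x, ∑ y, |empJoint s x y - J x y| / p x

lemma absError_sq_le (p : Fin n → ℝ) (J : Fin n → Fin n → ℝ) (s : Fin N → Fin n × Fin n) :
    absError p J s ^ 2 ≤ n ^ 2 * sqError p J s := by
  unfold absError sqError
  rw [← Fintype.sum_prod_type' (f := fun x y => |empJoint s x y - J x y| / p x),
    ← Fintype.sum_prod_type' (f := fun x y => (empJoint s x y - J x y) ^ 2 / p x ^ 2)]
  refine sq_sum_le_card_mul_sum_sq.trans (le_of_eq ?_)
  simp only [Finset.card_univ, Fintype.card_prod, Fintype.card_fin, div_pow, sq_abs]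
  push_cast
  ring

/-- Markov's inequality: the cell `(x, y)` has weighted mean square error at most `J x y / (N * p x
^ 2)`. Summing over `y` gives `1 / (N * p x) ≤ 1 / (δ * N)`, and there are `n` values of `x`. -/
lemma measure_sqError_ge_le {p : Fin n → ℝ} (hp : p ∈ stdSimplex ℝ (Fin n)) {δ : ℝ} (hδ : 0 < δ)
    (hpδ : ∀ x, δ ≤ p x) {pE : Fin m → ℝ} (hE : pE ∈ stdSimplex ℝ (Fin m))
    (f : Fin n × Fin m → Fin n) (hN : 0 < N) {τ : ℝ} (hτ : 0 < τ) :
    (Measure.pi fun _ : Fin N => scmLaw p pE f) {s | τ ≤ sqError p (scmJoint p pE f) s}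
      ≤ ENNReal.ofReal (n / (δ * N * τ)) := by
  have := isProbabilityMeasure_scmLaw hp hE f
  have hN' : (0 : ℝ) < N := by exact_mod_cast hN
  set P := Measure.pi fun _ : Fin N => scmLaw p pE f with hP
  have hMarkov := mul_meas_ge_le_integral_of_nonneg (μ := P) (f := sqError p (scmJoint p pE f))
    (Filter.Eventually.of_forall fun s => Finset.sum_nonneg fun x _ => Finset.sum_nonneg fun y _ =>
      div_nonneg (sq_nonneg _) (sq_nonneg _)) Integrable.of_finite τ
  have hpt : ∀ x y, ∫ s, (empJoint s x y - scmJoint p pE f x y) ^ 2 / p x ^ 2 ∂P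
      ≤ scmJoint p pE f x y / N / p x ^ 2 := by
    intro x y
    rw [integral_div]
    refine div_le_div_of_nonneg_right ?_ (sq_nonneg _)
    have h := integral_sq_average_sub_le (scmLaw p pE f)
      (fun ω => if ω.1 = x ∧ ω.2 = y then (1 : ℝ) else 0) (fun ω => by split_ifs <;> simp) hN
    have hI : ∫ ω, (if ω.1 = x ∧ ω.2 = y then (1 : ℝ) else 0) ∂scmLaw p pE f
        = scmJoint p pE f x y := by
      rw [← scmLaw_real_singleton hp.1 hE.1, ← integral_indicator_one (measurableSet_singleton _)]
      refine integral_congr_ae (Filter.Eventually.of_forall fun ω => ?_)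
      simp [Set.indicator_apply, Prod.ext_iff]
    rw [hI] at h
    exact h
  have hint : ∫ s, sqError p (scmJoint p pE f) s ∂P ≤ n / (δ * N) := by
    simp only [sqError]
    rw [integral_finsetSum _ fun x _ => Integrable.of_finite]
    have hx : ∀ x ∈ Finset.univ,
        ∫ s, ∑ y, (empJoint s x y - scmJoint p pE f x y) ^ 2 / p x ^ 2 ∂P ≤ 1 / (δ * N) := by
      intro x _
      have hpx : 0 < p x := hδ.trans_le (hpδ x)
      rw [integral_finsetSum _ fun y _ => Integrable.of_finite]
      refine (Finset.sum_le_sum fun y _ => hpt x y).trans ?_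
      rw [← Finset.sum_div, ← Finset.sum_div, sum_scmJoint p hE]
      rw [show p x / N / p x ^ 2 = 1 / (p x * N) by field_simp]
      exact one_div_le_one_div_of_le (by positivity) (mul_le_mul_of_nonneg_right (hpδ x) hN'.le)
    refine (Finset.sum_le_sum hx).trans (le_of_eq ?_)
    simp only [Finset.sum_const, Finset.card_univ, Fintype.card_fin, nsmul_eq_mul]
    ring
  refine (ENNReal.le_ofReal_iff_toReal_le (measure_ne_top _ _) (by positivity)).2 ?_
  rw [← div_div, le_div_iff₀ hτ, mul_comm]
  exact hMarkov.trans hint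

end Sampling

/-! ### Entropy bounds for a sample with small error -/

section Deterministic

variable {n m N : ℕ}

lemma abs_sub_le_of_absError_le {p : Fin n → ℝ} (hp : ∀ x, 0 < p x) {J : Fin n → Fin n → ℝ}
    {s : Fin N → Fin n × Fin n} {κ : ℝ} (h : absError p J s ≤ κ) (x y : Fin n) :
    |empJoint s x y - J x y| ≤ p x * κ := by
  have h1 : |empJoint s x y - J x y| / p x ≤ κ := by
    refine le_trans ?_ h
    refine le_trans ?_ (Finset.single_le_sum
      (f := fun x => ∑ y, |empJoint s x y - J x y| / p x) (fun x _ => Finset.sum_nonneg fun y _ =>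
        div_nonneg (abs_nonneg _) (hp x).le) (Finset.mem_univ x))
    exact Finset.single_le_sum (f := fun y => |empJoint s x y - J x y| / p x) (fun y _ =>
        div_nonneg (abs_nonneg _) (hp x).le) (Finset.mem_univ y)
  rwa [div_le_iff₀ (hp x), mul_comm] at h1

/-- Replacing the numerator costs the weighted error once; replacing the normalization `p x` by
`empX s x` costs it at most once more, hence the factor `2`. -/
lemma sum_abs_condYgivenX_sub_le {p : Fin n → ℝ} (hp : ∀ x, 0 < p x) {pE : Fin m → ℝ}
    (hE : pE ∈ stdSimplex ℝ (Fin m)) (f : Fin n × Fin m → Fin n) (s : Fin N → Fin n × Fin n)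
    (x : observedX s) :
    ∑ y, |∑ e with f (x, e) = y, pE e - condYgivenX s x y|
      ≤ 2 * ∑ y, |empJoint s x y - scmJoint p pE f x y| / p x := by
  have hX := empX_pos s x.2
  have hpx := hp x
  set S := ∑ y, |empJoint s x y - scmJoint p pE f x y| with hS
  have hXp : |empX s x - p x| ≤ S := by
    rw [← sum_empJoint_right, ← sum_scmJoint p hE f x, ← Finset.sum_sub_distrib]
    exact Finset.abs_sum_le_sum_abs _ _
  have hpt : ∀ y ∈ Finset.univ, |∑ e with f (x, e) = y, pE e - condYgivenX s x y|
      ≤ |empJoint s x y - scmJoint p pE f x y| / p x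
        + empJoint s x y / empX s x * (S / p x) := by
    intro y _
    have h1 : ∑ e with f (x, e) = y, pE e = scmJoint p pE f x y / p x := by
      simp only [scmJoint]; field_simp
    have h2 : ∑ e with f (x, e) = y, pE e - condYgivenX s x y
        = -((empJoint s x y - scmJoint p pE f x y) / p x)
          + empJoint s x y / empX s x * ((empX s x - p x) / p x) := by
      rw [h1, condYgivenX]; field_simp; ring
    rw [h2]
    refine (abs_add_le _ _).trans ?_
    rw [abs_neg, abs_div, abs_of_pos hpx, abs_mul, abs_div, abs_div, abs_of_pos hpx, abs_of_pos hX,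
      abs_of_nonneg (empJoint_nonneg s _ _)]
    gcongr
    exact div_nonneg (empJoint_nonneg s _ _) hX.le
  refine (Finset.sum_le_sum hpt).trans (le_of_eq ?_)
  rw [Finset.sum_add_distrib, ← Finset.sum_mul, ← Finset.sum_div, ← Finset.sum_div,
    sum_empJoint_right, div_self hX.ne', ← hS]
  ring

/-- The exogenous variable gives a coupling of low entropy in the causal direction. -/
lemma minCouplingEntropy_condYgivenX_le {p : Fin n → ℝ} (hp : ∀ x, 0 < p x) {pE : Fin m → ℝ}
    (hE : pE ∈ stdSimplex ℝ (Fin m)) (f : Fin n × Fin m → Fin n) (s : Fin N → Fin n × Fin n)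
    {κ : ℝ} (hκ : 2 * κ * (n * Real.logb 2 n) ≤ 1)
    (h : absError p (scmJoint p pE f) s ≤ κ) :
    minCouplingEntropy (condYgivenX s) ≤ entropy pE + 2 / Real.log 2 + 1 := by
  obtain ⟨r, hr, hrE⟩ := exists_isCoupling_of_map (ι := observedX s) pE hE fun x e => f (x, e)
  have hη : ∑ x : observedX s, ∑ y, |∑ e with f (x, e) = y, pE e - condYgivenX s x y|
      ≤ 2 * κ := by
    refine (Finset.sum_le_sum fun x _ => sum_abs_condYgivenX_sub_le hp hE f s x).trans ?_
    rw [← Finset.mul_sum]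
    refine mul_le_mul_of_nonneg_left ?_ zero_le_two
    refine le_trans ?_ h
    rw [Finset.sum_coe_sort (observedX s)
      fun x => ∑ y, |empJoint s x y - scmJoint p pE f x y| / p x]
    exact Finset.sum_le_sum_of_subset_of_nonneg (Finset.subset_univ _) fun x _ _ =>
      Finset.sum_nonneg fun y _ => div_nonneg (abs_nonneg _) (hp x).le
  have h1 := minCouplingEntropy_le_of_close _ (condYgivenX s) (condYgivenX_mem_stdSimplex s) r hr
    (2 * κ) hη
  have hκ0 : 0 ≤ 2 * κ := le_trans (Finset.sum_nonneg fun x _ => Finset.sum_nonneg fun y _ =>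
    abs_nonneg _) hη
  have h2 : 2 * κ * (Fintype.card (observedX s) * Real.logb 2 (Fintype.card (Fin n))) ≤ 1 := by
    refine le_trans (mul_le_mul_of_nonneg_left ?_ hκ0) hκ
    rw [Fintype.card_fin]
    rcases Nat.eq_zero_or_pos n with h0 | h0
    · simp [h0]
    refine mul_le_mul_of_nonneg_right ?_
      (Real.logb_nonneg (by norm_num) (by exact_mod_cast h0))
    rw [Fintype.card_coe]
    exact_mod_cast (Finset.card_le_univ _).trans (Fintype.card_fin n).le
  linarith

/-- If many `x` have comparable joint probabilities with `y`, then the entropy of `X` given `y`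
is large. -/
lemma le_minCouplingEntropy_condXgivenY (s : Fin N → Fin n × Fin n) (y : Fin n) (T : Finset (Fin n))
    {K : ℕ} (hK : 0 < K) (hKT : K ≤ T.card) {a : ℝ} (ha : 0 < a) (hn : 0 < n)
    (hlow : ∀ x ∈ T, a / n ≤ empJoint s x y) (hup : ∀ x ∈ T, empJoint s x y ≤ 5 / n)
    (hY : empY s y ≤ 7 * T.card / n) (hKa : 1 ≤ K * (a / 5)) :
    a / 7 * Real.logb 2 (K * (a / 5)) ≤ minCouplingEntropy (condXgivenY s) := by
  have hn' : (0 : ℝ) < n := by exact_mod_cast hn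
  have hT : (0 : ℝ) < T.card := by exact_mod_cast hK.trans_le hKT
  have hKT' : (K : ℝ) ≤ T.card := by exact_mod_cast hKT
  have hYlow : T.card * (a / n) ≤ empY s y := by
    rw [← sum_empJoint_left, ← nsmul_eq_mul]
    refine (Finset.card_nsmul_le_sum _ _ _ hlow).trans ?_
    exact Finset.sum_le_sum_of_subset_of_nonneg (Finset.subset_univ _) fun x _ _ =>
      empJoint_nonneg s _ _
  have hYpos : 0 < empY s y := lt_of_lt_of_le (by positivity) hYlow
  have hyo := mem_observedY_of_empY_pos s hYpos
  refine le_trans ?_ (entropy_le_minCouplingEntropy _ (condXgivenY_mem_stdSimplex s) ⟨y, hyo⟩)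
  have hq := condXgivenY_mem_stdSimplex s ⟨y, hyo⟩
  unfold entropy Real.logb
  rw [← mul_div_assoc]
  refine div_le_div_of_nonneg_right ?_ (Real.log_nonneg (by norm_num))
  have hKpos : (0 : ℝ) < K := by exact_mod_cast hK
  -- Each conditional probability on `T` is at least `a / (7 * |T|)`, so `T` carries mass at least
  -- `a / 7`, and at most `5 / (K * a)`, so each point has surprisal at least `log (K * (a / 5))`.
  have hpt : ∀ x ∈ T, a / (7 * T.card) * Real.log (K * (a / 5))
      ≤ Real.negMulLog (condXgivenY s ⟨y, hyo⟩ x) := by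
    intro x hx
    have h1 : a / (7 * T.card) ≤ condXgivenY s ⟨y, hyo⟩ x := by
      simp only [condXgivenY]
      rw [le_div_iff₀ hYpos]
      refine le_trans (mul_le_mul_of_nonneg_left hY (by positivity)) (le_trans (le_of_eq ?_)
        (hlow x hx))
      field_simp
    have h2 : condXgivenY s ⟨y, hyo⟩ x ≤ (K * (a / 5))⁻¹ := by
      simp only [condXgivenY]
      rw [div_le_iff₀ hYpos]
      refine (hup x hx).trans ?_
      refine le_trans (le_of_eq ?_) (mul_le_mul_of_nonneg_left
        (le_trans (mul_le_mul_of_nonneg_right hKT' (by positivity)) hYlow) (by positivity))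
      field_simp
    have h3 : 0 < condXgivenY s ⟨y, hyo⟩ x := lt_of_lt_of_le (by positivity) h1
    have h4 := Real.log_le_log h3 h2
    rw [Real.log_inv] at h4
    have h5 : 0 ≤ Real.log (K * (a / 5)) := Real.log_nonneg hKa
    simp only [Real.negMulLog]
    rw [neg_mul_comm]
    exact mul_le_mul h1 (by linarith) h5 h3.le
  calc a / 7 * Real.log (K * (a / 5))
      = T.card • (a / (7 * T.card) * Real.log (K * (a / 5))) := by
        rw [nsmul_eq_mul]; field_simp
    _ ≤ ∑ x ∈ T, Real.negMulLog (condXgivenY s ⟨y, hyo⟩ x) := Finset.card_nsmul_le_sum _ _ _ hpt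
    _ ≤ _ := Finset.sum_le_sum_of_subset_of_nonneg (Finset.subset_univ _) fun x _ _ =>
        Real.negMulLog_nonneg (hq.1 x) (by
          rw [← hq.2]; exact Finset.single_le_sum (fun i _ => hq.1 i) (Finset.mem_univ x))

/-- Shannon entropy dominates min-entropy: the average surprisal is at least the surprisal of the
likeliest value. -/
lemma exists_rpow_neg_entropy_le {pE : Fin m → ℝ} (hE : pE ∈ stdSimplex ℝ (Fin m)) {c : ℝ}
    (hc : entropy pE ≤ c) : ∃ e, (2 : ℝ) ^ (-c) ≤ pE e := by
  have hne : (Finset.univ : Finset (Fin m)).Nonempty := by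
    rw [Finset.nonempty_iff_ne_empty]
    intro h
    have := hE.2
    rw [h] at this
    simp at this
  obtain ⟨e, -, he⟩ := Finset.exists_max_image Finset.univ pE hne
  have hpos : 0 < pE e := by
    by_contra h
    have : ∑ e, pE e ≤ 0 := Finset.sum_nonpos fun i hi => (he i hi).trans (not_lt.1 h)
    linarith [hE.2]
  refine ⟨e, ?_⟩
  have hlog2 : 0 < Real.log 2 := Real.log_pos (by norm_num)
  have h1 : -Real.log (pE e) ≤ ∑ i, Real.negMulLog (pE i) := by
    calc -Real.log (pE e) = ∑ i, pE i * -Real.log (pE e) := by rw [← Finset.sum_mul, hE.2, one_mul]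
      _ ≤ _ := by
        refine Finset.sum_le_sum fun i hi => ?_
        rcases (hE.1 i).eq_or_lt with h | h
        · rw [← h]; simp
        · simp only [Real.negMulLog]
          have := Real.log_le_log h (he i hi)
          nlinarith
  unfold entropy at hc
  rw [div_le_iff₀ hlog2] at hc
  rw [← Real.log_le_log_iff (by positivity) hpos, Real.log_rpow (by norm_num)]
  linarith

end Deterministic

/-! ### Heavy outputs of a random mechanism -/

section HeavyOutput

variable {n m : ℕ}

/-- The mechanism `f` sends, for the exogenous value `e`, at least `K` elements of `G` to some `y`
whose total probability is, up to `2 / n`, accounted for by these elements. -/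
def HasHeavyOutput (p : Fin n → ℝ) (pE : Fin m → ℝ) (e : Fin m) (G : Finset (Fin n)) (K : ℕ)
    (f : Fin n × Fin m → Fin n) : Prop :=
  ∃ y, K ≤ (G.filter fun x => f (x, e) = y).card ∧
    ∑ x, scmJoint p pE f x y ≤ 2 / n + ∑ x ∈ G.filter (fun x => f (x, e) = y), p x * pE e

lemma half_le_card_filter_le {β : Type*} [Fintype β] (R : β → ℝ) (hR : ∀ y, 0 ≤ R y)
    (hs : ∑ y, R y ≤ 1) : (Fintype.card β : ℝ) / 2
      ≤ (Finset.univ.filter fun y => R y ≤ 2 / Fintype.card β).card := by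
  classical
  rcases Nat.eq_zero_or_pos (Fintype.card β) with h0 | h0
  · rw [h0]; simp
  have hn : (0 : ℝ) < Fintype.card β := by exact_mod_cast h0
  have h1 : ((Finset.univ.filter fun y => ¬ R y ≤ 2 / Fintype.card β).card : ℝ)
      * (2 / Fintype.card β) ≤ 1 := by
    refine le_trans ?_ hs
    rw [← nsmul_eq_mul]
    refine (Finset.card_nsmul_le_sum _ _ _ fun y hy => (not_le.1 (Finset.mem_filter.1 hy).2).le).trans ?_
    exact Finset.sum_le_sum_of_subset_of_nonneg (Finset.subset_univ _) fun y _ _ => hR y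
  rw [mul_div_assoc', div_le_one hn] at h1
  have h2 := Finset.card_filter_add_card_filter_not (s := (Finset.univ : Finset β))
    (fun y => R y ≤ 2 / Fintype.card β)
  rw [Finset.card_univ] at h2
  have h3 : ((Finset.univ.filter fun y => R y ≤ 2 / Fintype.card β).card : ℝ)
      + (Finset.univ.filter fun y => ¬ R y ≤ 2 / Fintype.card β).card = Fintype.card β := by
    exact_mod_cast h2
  linarith

-- Fix `f` off the pairs `(x, e)` with `x ∈ G`. The mass `R` already placed on outputs totals at
-- most `1`, so at least half of the outputs carry at most `2 / n`. The remaining values of `f` are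
-- at least `n / 2` independent balls, and the balls-in-bins bound applies to these light outputs.
open scoped Classical in
lemma uniformOn_not_hasHeavyOutput_le (K : ℕ) {η : ℝ} (hη : 0 < η) : ∃ A : ℕ, ∀ (n m : ℕ)
    (p : Fin n → ℝ) (pE : Fin m → ℝ) (e : Fin m) (G : Finset (Fin n)),
    p ∈ stdSimplex ℝ (Fin n) → pE ∈ stdSimplex ℝ (Fin m) → (n : ℝ) / 2 ≤ G.card → 2 * A ≤ n →
      uniformOn (Set.univ : Set (Fin n × Fin m → Fin n)) {f | ¬ HasHeavyOutput p pE e G K f}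
        ≤ ENNReal.ofReal η := by
  obtain ⟨A, hA⟩ := exists_card_filter_fiber_lt_le K η (1 / 2) hη (by norm_num)
  refine ⟨A, fun n m p pE e G hp hE hG hn => ?_⟩
  set P : Fin n × Fin m → Prop := fun i => i.2 = e ∧ i.1 ∈ G with hP
  have hw0 : ∀ i : Fin n × Fin m, 0 ≤ p i.1 * pE i.2 := fun i => mul_nonneg (hp.1 _) (hE.1 _)
  have hw1 : ∑ i : Fin n × Fin m, p i.1 * pE i.2 = 1 := by
    rw [Fintype.sum_prod_type]
    simp only
    simp only [← Finset.mul_sum, hE.2, mul_one, hp.2]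
  set R : ({i // ¬ P i} → Fin n) → Fin n → ℝ := fun b y =>
    ∑ i, if b i = y then p i.1.1 * pE i.1.2 else 0 with hR
  have hR0 : ∀ b y, 0 ≤ R b y := fun b y => Finset.sum_nonneg fun i _ => by
    split_ifs
    · exact hw0 _
    · exact le_rfl
  have hR1 : ∀ b, ∑ y, R b y ≤ 1 := by
    intro b
    simp only [hR]
    rw [Finset.sum_comm]
    simp only [Finset.sum_ite_eq, Finset.mem_univ, if_true]
    rw [← hw1, ← Fintype.sum_subtype_add_sum_subtype P fun i => p i.1 * pE i.2]
    exact le_add_of_nonneg_left (Finset.sum_nonneg fun i _ => hw0 _)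
  set Y : ({i // ¬ P i} → Fin n) → Finset (Fin n) := fun b =>
    Finset.univ.filter fun y => R b y ≤ 2 / n with hY
  have hYcard : ∀ b, A ≤ (Y b).card := by
    intro b
    have h1 := half_le_card_filter_le (R b) (hR0 b) (hR1 b)
    rw [Fintype.card_fin] at h1
    have h2 : (2 * A : ℝ) ≤ n := by exact_mod_cast hn
    have h3 : (A : ℝ) ≤ (Y b).card := by linarith
    exact_mod_cast h3
  have hPcard : Fintype.card {i // P i} = G.card := by
    rw [Fintype.card_subtype]
    refine Finset.card_bij' (fun i _ => i.1) (fun x _ => (x, e)) ?_ ?_ ?_ ?_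
    · intro i hi; exact (Finset.mem_filter.1 hi).2.2
    · intro x hx; exact Finset.mem_filter.2 ⟨Finset.mem_univ _, rfl, hx⟩
    · intro i hi; exact Prod.ext rfl (Finset.mem_filter.1 hi).2.1.symm
    · intro x _; rfl
  have hcount : ((Finset.univ.filter fun f : Fin n × Fin m → Fin n =>
      ¬ HasHeavyOutput p pE e G K f).card : ℝ)
        ≤ (η + 0) * (Fintype.card (Fin n) : ℝ) ^ Fintype.card (Fin n × Fin m) := by
    refine card_filter_le_of_restrict P (fun f => ¬ HasHeavyOutput p pE e G K f)
      (fun (g : {i // P i} → Fin n) (b : {i // ¬ P i} → Fin n) =>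
        ∀ y ∈ Y b, (Finset.univ.filter fun i => g i = y).card < K) ?_
      (fun _ => False) (η' := 0) hη.le (by simp) ?_
    · intro f hf y hy
      by_contra hcard
      refine hf ⟨y, (not_lt.1 hcard).trans ?_, ?_⟩
      · refine Finset.card_le_card_of_injOn (fun i => i.1.1) ?_ ?_
        · rintro ⟨⟨x, e'⟩, he, hx⟩ hi
          simp only at he hx
          subst he
          simp only [Finset.coe_filter, Set.mem_ofPred_eq, Finset.mem_univ, true_and] at hi ⊢
          exact ⟨hx, hi⟩
        · rintro ⟨⟨x, e1⟩, h1, _⟩ _ ⟨⟨x', e2⟩, h2, _⟩ _ hxx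
          exact Subtype.ext (Prod.ext hxx (h1.trans h2.symm))
      · have h1 : ∑ x, scmJoint p pE f x y
            = ∑ i : Fin n × Fin m, if f i = y then p i.1 * pE i.2 else 0 := by
          rw [Fintype.sum_prod_type]
          refine Finset.sum_congr rfl fun x _ => ?_
          rw [scmJoint, Finset.mul_sum, Finset.sum_filter]
        have h2 : ∑ i : {i // P i}, (if f i = y then p i.1.1 * pE i.1.2 else 0)
            = ∑ x ∈ G.filter (fun x => f (x, e) = y), p x * pE e := by
          rw [← Finset.sum_subtype (Finset.univ.filter P) (by simp)
            fun i => if f i = y then p i.1 * pE i.2 else 0]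
          rw [← Finset.sum_filter]
          refine Finset.sum_bij' (fun i _ => i.1) (fun x _ => (x, e)) ?_ ?_ ?_ ?_ ?_
          · rintro ⟨x, e'⟩ hi
            simp only [hP, Finset.mem_filter, Finset.mem_univ, true_and] at hi ⊢
            obtain ⟨⟨rfl, hx⟩, hfy⟩ := hi
            exact ⟨hx, hfy⟩
          · intro x hx
            simp only [hP, Finset.mem_filter, Finset.mem_univ, true_and] at hx ⊢
            exact hx
          · rintro ⟨x, e'⟩ hi
            simp only [hP, Finset.mem_filter, Finset.mem_univ, true_and] at hi
            rw [hi.1.1]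
          · intro x _; rfl
          · rintro ⟨x, e'⟩ hi
            simp only [hP, Finset.mem_filter, Finset.mem_univ, true_and] at hi
            rw [hi.1.1]
        have h3 := (Finset.mem_filter.1 hy).2
        rw [h1, ← Fintype.sum_subtype_add_sum_subtype P, h2, add_comm]
        exact add_le_add_left h3 _
    · intro b _
      have hPG : 1 / 2 * (Fintype.card (Fin n) : ℝ) ≤ Fintype.card {i // P i} := by
        rw [Fintype.card_fin, hPcard]
        linarith
      refine le_trans (le_of_eq ?_) ((hA {i // P i} (Fin n) hPG (Y b) (hYcard b)).trans
        (le_of_eq ?_)) <;> congr!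
  rw [add_zero] at hcount
  rw [uniformOn_univ, ← Set.coe_toFinset {f | ¬ HasHeavyOutput p pE e G K f},
    Measure.count_apply_finset]
  refine ENNReal.div_le_of_le_mul ?_
  rw [← ENNReal.ofReal_natCast, ← ENNReal.ofReal_natCast, ← ENNReal.ofReal_mul hη.le]
  refine ENNReal.ofReal_le_ofReal (le_trans (le_of_eq ?_) (hcount.trans (le_of_eq ?_)))
  · congr 2
    ext f
    simp
  · rw [Fintype.card_fun, Nat.cast_pow]

end HeavyOutput

/-! ### Comparing the two directions -/

section Comparison

variable {n m N : ℕ}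

/-- A small sampling error and a heavy output make the anticausal entropy exceed the causal one. -/
lemma minCouplingEntropy_lt_of_absError_le {p : Fin n → ℝ} (hp : p ∈ stdSimplex ℝ (Fin n))
    (hpos : ∀ x, 0 < p x) {pE : Fin m → ℝ} (hE : pE ∈ stdSimplex ℝ (Fin m)) {c a β : ℝ}
    (hc : entropy pE ≤ c) {e : Fin m} (ha : 0 < a) (hβ : 0 < β) (he : β ≤ pE e)
    (G : Finset (Fin n)) (hG : ∀ x ∈ G, a / n ≤ p x ∧ p x ≤ 4 / n) {K : ℕ} (hK : 0 < K)
    (hK1 : 1 ≤ K * (a * β / 2 / 5))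
    (hK2 : c + 2 / Real.log 2 + 1 < a * β / 2 / 7 * Real.logb 2 (K * (a * β / 2 / 5)))
    {f : Fin n × Fin m → Fin n} (hf : HasHeavyOutput p pE e G K f) (s : Fin N → Fin n × Fin n)
    {κ : ℝ} (hn : 0 < n) (hκ1 : κ ≤ 1 / n) (hκ2 : κ ≤ 1 / 4) (hκ3 : 8 * κ ≤ a * β)
    (hκ4 : 2 * κ * (n * Real.logb 2 n) ≤ 1) (h : absError p (scmJoint p pE f) s ≤ κ) :
    minCouplingEntropy (condYgivenX s) < minCouplingEntropy (condXgivenY s) := by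
  have hn' : (0 : ℝ) < n := by exact_mod_cast hn
  have hup := minCouplingEntropy_condYgivenX_le hpos hE f s hκ4 h
  obtain ⟨y, hy1, hy2⟩ := hf
  set T := G.filter fun x => f (x, e) = y with hT
  have hT1 : (1 : ℝ) ≤ T.card := by exact_mod_cast hK.trans_le hy1
  have hκ0 : 0 ≤ κ := le_trans (Finset.sum_nonneg fun x _ => Finset.sum_nonneg fun y _ =>
    div_nonneg (abs_nonneg _) (hpos x).le) h
  have herr := abs_sub_le_of_absError_le hpos h
  have he1 : pE e ≤ 1 := by
    rw [← hE.2]; exact Finset.single_le_sum (fun i _ => hE.1 i) (Finset.mem_univ e)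
  have herrT : ∀ x ∈ T, |empJoint s x y - scmJoint p pE f x y| ≤ 4 / n * κ := fun x hx =>
    (herr x y).trans (mul_le_mul_of_nonneg_right (hG x (Finset.mem_filter.1 hx).1).2 hκ0)
  -- The true joint probability is at least `a * β / n`; half of it is given up to sampling error.
  have hlow : ∀ x ∈ T, a * β / 2 / n ≤ empJoint s x y := by
    intro x hx
    obtain ⟨hxG, hxy⟩ := Finset.mem_filter.1 hx
    have h1 : a / n * β ≤ scmJoint p pE f x y := by
      refine mul_le_mul (hG x hxG).1 (he.trans ?_) hβ.le (hpos x).le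
      exact Finset.single_le_sum (f := pE) (fun i _ => hE.1 i)
        (Finset.mem_filter.2 ⟨Finset.mem_univ e, hxy⟩)
    have h2 := (abs_le.1 (herrT x hx)).1
    have h3 : 4 / n * κ ≤ a * β / 2 / n := by
      rw [div_mul_eq_mul_div]
      exact div_le_div_of_nonneg_right (by linarith) hn'.le
    have h4 : a / n * β = a * β / 2 / n + a * β / 2 / n := by ring
    linarith
  have hupT : ∀ x ∈ T, empJoint s x y ≤ 5 / n := by
    intro x hx
    have h1 : scmJoint p pE f x y ≤ p x := by
      refine mul_le_of_le_one_right (hpos x).le ?_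
      rw [← hE.2]
      exact Finset.sum_le_sum_of_subset_of_nonneg (Finset.subset_univ _) fun i _ _ => hE.1 i
    have h2 := (abs_le.1 (herrT x hx)).2
    have h3 : 4 / n * κ ≤ 1 / n := by
      rw [div_mul_eq_mul_div]
      exact div_le_div_of_nonneg_right (by linarith) hn'.le
    have h4 := (hG x (Finset.mem_filter.1 hx).1).2
    have h5 : (5 : ℝ) / n = 4 / n + 1 / n := by ring
    linarith
  -- The `7` is `4` from the elements of `T`, `2` from the remaining mass on `y` and `1` from
  -- sampling error; the last two are absorbed using `1 ≤ |T|`.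
  have hYup : empY s y ≤ 7 * T.card / n := by
    have h1 : empY s y - ∑ x, scmJoint p pE f x y ≤ κ := by
      rw [← sum_empJoint_left, ← Finset.sum_sub_distrib]
      calc ∑ x, (empJoint s x y - scmJoint p pE f x y) ≤ ∑ x, p x * κ :=
            Finset.sum_le_sum fun x _ => (le_abs_self _).trans (herr x y)
        _ = κ := by rw [← Finset.sum_mul, hp.2, one_mul]
    have h2 : ∑ x ∈ T, p x * pE e ≤ T.card * (4 / n) := by
      rw [← nsmul_eq_mul]
      refine Finset.sum_le_card_nsmul _ _ _ fun x hx => ?_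
      exact (mul_le_of_le_one_right (hpos x).le he1).trans (hG x (Finset.mem_filter.1 hx).1).2
    have h3 : 3 / (n : ℝ) ≤ 3 * T.card / n := div_le_div_of_nonneg_right (by linarith) hn'.le
    have h4 : 7 * (T.card : ℝ) / n = T.card * (4 / n) + 3 * T.card / n := by ring
    have h5 : 3 / (n : ℝ) = 2 / n + 1 / n := by ring
    linarith
  have := le_minCouplingEntropy_condXgivenY s y T hK hy1 (a := a * β / 2) (by positivity) hn hlow
    hupT hYup hK1
  linarith

end Comparison

end EntropicCausality

open EntropicCausality
open Filter in
theorem corollary3 (c C ε : ℝ) (hC : 0 < C) (hε : 0 < ε) :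
    ∃ n₀ : ℕ, ∀ n : ℕ, n₀ ≤ n →
      ∀ (m : ℕ) (pE : Fin m → ℝ), pE ∈ stdSimplex ℝ (Fin m) → entropy pE ≤ c →
      ∀ N : ℕ, C * (n : ℝ) ^ 8 * Real.logb 2 (n : ℝ) ^ 5 ≤ (N : ℝ) →
        ENNReal.ofReal (1 - ε) ≤
          dataLaw n pE N
            {s | minCouplingEntropy (condYgivenX s) < minCouplingEntropy (condXgivenY s)} := by
  -- These choices make the exceptional inputs cost `δ + 4 * a = ε / 2`; the mechanism and the
  -- sampling get `ε / 4` each.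
  set a : ℝ := ε / 16 with ha_def
  set δ : ℝ := ε / 4 with hδ_def
  set β : ℝ := (2 : ℝ) ^ (-c) with hβ_def
  have ha : 0 < a := by positivity
  have hδ : 0 < δ := by positivity
  have hβ : 0 < β := by positivity
  have hlim : Tendsto (fun K : ℕ => (K : ℝ) * (a * β / 2 / 5)) atTop atTop :=
    tendsto_natCast_atTop_atTop.atTop_mul_const (by positivity)
  have hlim2 : Tendsto (fun K : ℕ => a * β / 2 / 7 * Real.logb 2 (K * (a * β / 2 / 5)))
      atTop atTop :=
    ((Real.tendsto_logb_atTop (by norm_num)).comp hlim).const_mul_atTop (by positivity)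
  -- `K` depends only on `c` and `ε`, so the balls-in-bins threshold `A` is uniform in `m`, `pE` and
  -- `N`.
  obtain ⟨K, hK, hK1, hK2⟩ := ((eventually_gt_atTop 0).and ((hlim.eventually_ge_atTop 1).and
    (hlim2.eventually_gt_atTop (c + 2 / Real.log 2 + 1)))).exists
  obtain ⟨A, hA⟩ := uniformOn_not_hasHeavyOutput_le K (η := ε / 4) (by positivity)
  obtain ⟨n₀, hn₀⟩ := eventually_atTop.1 ((eventually_ge_atTop 2).and ((eventually_ge_atTop (2 * A)).and
    ((tendsto_natCast_atTop_atTop.eventually_ge_atTop (4 / (a * β))).and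
      (tendsto_natCast_atTop_atTop.eventually_ge_atTop (4 / (δ * C * (ε / 4)))))))
  refine ⟨n₀, fun n hn m pE hE hc N hN => ?_⟩
  obtain ⟨hn2, hnA, hnβ, hnC⟩ := hn₀ n hn
  have hn2' : (2 : ℝ) ≤ n := by exact_mod_cast hn2
  have hnpos : (0 : ℝ) < n := by linarith
  obtain ⟨e, he⟩ := exists_rpow_neg_entropy_le hE hc
  set ℓ := Real.logb 2 (n : ℝ) with hℓ
  have hℓ1 : 1 ≤ ℓ := by
    rw [hℓ, Real.le_logb_iff_rpow_le (by norm_num) hnpos, Real.rpow_one]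
    exact hn2'
  have hNpos' : (0 : ℝ) < N := lt_of_lt_of_le (by positivity) hN
  have hNpos : 0 < N := by exact_mod_cast hNpos'
  -- The largest error for which the correction `2 * κ * (n * ℓ)` in the causal bound is at most one
  -- bit.
  set κ : ℝ := 1 / (2 * n * ℓ) with hκ
  have hκpos : 0 < κ := by positivity
  have hκn : κ ≤ 1 / (2 * n) := by
    refine one_div_le_one_div_of_le (by positivity) ?_
    nlinarith
  have h2n : 1 / (2 * (n : ℝ)) ≤ 1 / 4 := one_div_le_one_div_of_le (by norm_num) (by linarith)
  have h1n : 1 / (2 * (n : ℝ)) ≤ 1 / n := one_div_le_one_div_of_le hnpos (by linarith)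
  have h8 : 8 * κ ≤ a * β := by
    have h1 : 4 / n ≤ a * β := by
      rw [div_le_iff₀ (by positivity)] at hnβ ⊢
      linarith
    have h2 : 8 * (1 / (2 * (n : ℝ))) = 4 / n := by ring
    linarith
  obtain ⟨k, rfl⟩ : ∃ k, n = k + 1 := ⟨n - 1, by omega⟩
  set n : ℕ := k + 1 with hn_def
  have hprob := isProbabilityMeasure_dataLaw (k := k) hE N
  set S : Set (Fin N → Fin n × Fin n) :=
    {s | minCouplingEntropy (condYgivenX s) < minCouplingEntropy (condXgivenY s)} with hS
  have hbound : dataLaw n pE N Sᶜ ≤ ENNReal.ofReal ε := by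
    refine (dataLaw_le hE N Sᶜ (spreadInputs n δ a) (fun p hp => hp.1)
      (fun p => {f | ¬ HasHeavyOutput p pE e
        (Finset.univ.filter fun i => a / n ≤ p i ∧ p i ≤ 4 / n) K f})
      (ENNReal.ofReal (ε / 4)) (ENNReal.ofReal (ε / 4)) ?_ ?_).trans ?_
    · intro p hp
      exact hA n m p pE e _ hp.1 hE hp.2.2 hnA
    · intro p hp f hf
      have hδn : 0 < δ / (n : ℝ) ^ 2 := by positivity
      have hτ : 0 < (κ / n) ^ 2 := by positivity
      refine (measure_mono ?_).trans ((measure_sqError_ge_le hp.1 hδn hp.2.1 hE f hNpos hτ).trans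
        (ENNReal.ofReal_le_ofReal ?_))
      · intro s hs
        by_contra hcon
        refine hs ?_
        have h1 : sqError p (scmJoint p pE f) s < (κ / n) ^ 2 := not_le.1 hcon
        have h2 : absError p (scmJoint p pE f) s ≤ κ := by
          refine abs_le_of_sq_le_sq' ?_ hκpos.le |>.2
          refine (absError_sq_le p _ s).trans ?_
          calc (n : ℝ) ^ 2 * sqError p (scmJoint p pE f) s ≤ (n : ℝ) ^ 2 * (κ / n) ^ 2 :=
                mul_le_mul_of_nonneg_left h1.le (by positivity)
            _ = κ ^ 2 := by field_simp
        refine minCouplingEntropy_lt_of_absError_le hp.1 (fun x => hδn.trans_le (hp.2.1 x)) hE hc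
          ha hβ he _ (fun x hx => (Finset.mem_filter.1 hx).2) hK hK1 hK2 (not_not.1 hf) s
          (by omega) (hκn.trans h1n) (hκn.trans h2n) h8 (le_of_eq ?_) h2
        rw [← hℓ, hκ]
        field_simp
      -- The failure probability has order `n ^ 7 * ℓ ^ 2 / N`. The assumed sample size leaves a
      -- spare factor `n`, which absorbs the constants including `1 / C`.
      · have h1 : (n : ℝ) / (δ / (n : ℝ) ^ 2 * N * (κ / n) ^ 2) = 4 * n ^ 7 * ℓ ^ 2 / (δ * N) := by
          rw [hκ]; field_simp; norm_num
        have h4 : 4 ≤ ε / 4 * (δ * C * n) := by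
          rw [div_le_iff₀ (by positivity)] at hnC
          linarith
        rw [h1, div_le_iff₀ (by positivity)]
        have h5 : ℓ ^ 2 ≤ ℓ ^ 5 := pow_le_pow_right₀ hℓ1 (by norm_num)
        calc 4 * (n : ℝ) ^ 7 * ℓ ^ 2 ≤ ε / 4 * (δ * C * n) * n ^ 7 * ℓ ^ 5 := by gcongr
          _ = ε / 4 * (δ * (C * n ^ 8 * ℓ ^ 5)) := by ring
          _ ≤ ε / 4 * (δ * N) := by gcongr
    · have h1 : simplexUniform n (spreadInputs n δ a)ᶜ ≤ ENNReal.ofReal (ε / 2) := by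
        have := isProbabilityMeasure_simplexUniform k
        rw [← ENNReal.ofReal_toReal (measure_ne_top (simplexUniform n) _)]
        refine ENNReal.ofReal_le_ofReal
          ((simplexUniform_compl_spreadInputs_le k hδ.le ha.le).trans (le_of_eq ?_))
        rw [hδ_def, ha_def]; ring
      refine (add_le_add_left h1 _).trans (le_of_eq ?_)
      rw [← ENNReal.ofReal_add (by positivity) (by positivity),
        ← ENNReal.ofReal_add (by positivity) (by positivity)]
      congr 1
      ring
  have hcompl := prob_add_prob_compl (μ := dataLaw n pE N) S.toFinite.measurableSet
  rw [ENNReal.ofReal_sub _ hε.le, ENNReal.ofReal_one, ← hcompl]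
  exact tsub_le_iff_right.2 (add_le_add_right hbound _)
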